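/- Let $T$ be a standard Young tableau with $N$ boxes and at most three rows; rows get longer from top to bottom, and entries increase from left to right along rows and from bottom to top along columns. The $\mathsf{m}$-diagram of $T$ is drawn above a horizontal boundary line with marked points $1,\dots,N$: for $i=1,\dots,N$ in turn, if $i$ is not on the bottom row, join $i$ by a semicircle to the largest $j<i$ on the row immediately below the row of $i$ that is not yet on an arc with another number from the row of $i$. Arcs between the bottom and middle rows are called first arcs, arcs between the middle and top rows second arcs. The resolved $\mathsf{m}$-diagram is the directed plane graph obtained as follows: (i) replace each marked point lying on two arcs by a small $Y$, whose stem is attached to the boundary line and directed away from it; (ii) direct first arcs from left to right and second arcs from right to left; (iii) replace each crossing of two arcs by two trivalent vertices, one incident to the two incoming edges and the other incident to the two outgoing edges, joined by a new edge directed from the latter (the source) to the former (the sink). Closing up the boundary line to a circle, this graph lies in a disk. A boundary vertex is a marked point lying on an arc. An interior face is a face of the graph in the disk that has no segment of the boundary line on its boundary. An $\mathfrak{sl}_3$-web is a planar directed graph with boundary, drawn in a disk, whose internal vertices are trivalent, whose boundary vertices have degree one, and each of whose vertices is a source or a sink. It is non-elliptic (irreducible, reduced) if each of its interior faces has at least six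 edges on its boundary. Then: 1. The resolved $\mathsf{m}$-diagram of $T$ has no interior face with exactly two edges on its boundary. 2. It has no interior face with an odd number of edges on its boundary. 3. It has no interior face with exactly four edges on its boundary. 4. Hence the resolved $\mathsf{m}$-diagram of $T$ (marked points on no arc being disregarded) is a non-elliptic (irreducible) $\mathfrak{sl}_3$-web. 5. In particular, this holds if $T$ has shape $(n,k,k)$ with $n\le k$ (top row of length $n$); in that case every marked point $1,\dots,N$ lies on an arc, so the resolved $\mathsf{m}$-diagram is an irreducible web with boundary vertices $1,\dots,N$. -/

import Mathlib

/-! # Standard tableaux -/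

/-- A standard Young tableau of shape `μ`: the cells are numbered bijectively by
`0, 1, …, N - 1` (standing for the entries `1, 2, …, N`, where `N = μ.card`), increasing along rows
and along columns.  Row `0` is the longest row of `μ`; in the convention in which row lengths
increase from top to bottom and columns increase from bottom to top, it is the bottom row. -/
structure StandardTableau (μ : YoungDiagram) where
  entry : {c : ℕ × ℕ // c ∈ μ.cells} ≃ Fin μ.card
  row_lt : ∀ (i j₁ j₂ : ℕ) (h₁ : (i, j₁) ∈ μ.cells) (h₂ : (i, j₂) ∈ μ.cells),
    j₁ < j₂ → entry ⟨(i, j₁), h₁⟩ < entry ⟨(i, j₂), h₂⟩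
  col_lt : ∀ (i₁ i₂ j : ℕ) (h₁ : (i₁, j) ∈ μ.cells) (h₂ : (i₂, j) ∈ μ.cells),
    i₁ < i₂ → entry ⟨(i₁, j), h₁⟩ < entry ⟨(i₂, j), h₂⟩

/-- The row containing a given number (`0` is the bottom row). -/
def StandardTableau.row {μ : YoungDiagram} (T : StandardTableau μ) (k : Fin μ.card) : ℕ :=
  (T.entry.symm k).1.1

/-! # Graphs drawn in a disk, and webs -/

/-- Data of a graph drawn in a closed disk, the boundary circle of the disk being part of the
graph, given as a combinatorial map (rotation system) on half-edges.  A half-edge is an end of an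
edge, based at a vertex and pointing away from it.  The vertices are the orbits of `rot`, the edges
the orbits of `opp`, the faces the orbits of `rot ∘ opp`. The laws are imposed in
`DiskGraph.IsWeb`. -/
structure DiskGraph where
  /-- The half-edges. -/
  Half : Type
  /-- The counterclockwise next half-edge at the same vertex. -/
  rot : Half → Half
  /-- The other half of the same edge. -/
  opp : Half → Half
  /-- The half-edges that lie on the boundary circle; all others belong to the web. -/
  line : Set Half
  /-- For a half-edge of the web: its edge is directed away from the vertex it is based at. -/
  out : Half → Prop

namespace DiskGraph

/-- `e` lies on the orbit of `d` under iteration of `f`. -/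
def OnOrbit {α : Type} (f : α → α) (d e : α) : Prop := ∃ n : ℕ, f^[n] d = e

/-- The number of orbits of `f`. -/
noncomputable def numOrbits {α : Type} (f : α → α) : ℕ :=
  (Set.range fun d => {e | OnOrbit f d e}).ncard

variable (G : DiskGraph)

/-- One step along the boundary of the face on the right of a half-edge: run along the edge to its
other end, and turn right there. -/
def faceStep (d : G.Half) : G.Half := G.rot (G.opp d)

/-- The number of edges on the boundary of the face on the right of `d`, i.e. the length of its
boundary walk. -/
noncomputable def faceLength (d : G.Half) : ℕ := Function.minimalPeriod G.faceStep d

/-- The face on the right of `d` is interior: it has no edge on the boundary circle. -/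
def IsInteriorFace (d : G.Half) : Prop := ∀ e, OnOrbit G.faceStep d e → e ∉ G.line

/-- The number of connected components. -/
noncomputable def numComponents : ℕ :=
  Nat.card (Quot fun d e : G.Half => e = G.rot d ∨ e = G.opp d)

/-- Planarity of the combinatorial map (genus zero): Euler's formula `V - E + F = 2 C`. -/
def IsPlanar : Prop :=
  numOrbits G.rot + numOrbits G.faceStep = numOrbits G.opp + 2 * G.numComponents

/-- `G` is an `𝔰𝔩₃`-web in a disk: a planar directed graph, with boundary vertices of degree one
and trivalent internal vertices, in which every vertex is a source or a sink.  Points of the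
boundary circle carrying no edge of the web may be marked; they are not counted as boundary
vertices of the web (see `NoIsolatedPoint`). -/
structure IsWeb : Prop where
  finite : Finite G.Half
  rot_bijective : Function.Bijective G.rot
  opp_opp : ∀ d, G.opp (G.opp d) = d
  opp_ne : ∀ d, G.opp d ≠ d
  planar : G.IsPlanar
  /-- The boundary circle bounds the outside of the disk: one of the two sides of each of its edges
  is on the outside, the outside is a single face, and its boundary walk is a simple closed
  curve. -/
  circle : ∃ outer : Set G.Half,
    (∀ d, d ∈ G.line ↔ d ∈ outer ∨ G.opp d ∈ outer) ∧
    (∀ d ∈ outer, G.opp d ∉ outer) ∧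
    (∀ d ∈ outer, ∀ e, e ∈ outer ↔ OnOrbit G.faceStep d e) ∧
    (∀ d ∈ outer, ∀ e ∈ outer, OnOrbit G.rot d e → d = e)
  /-- At most one edge of the web ends at a given point of the boundary circle. -/
  boundary_degree : ∀ d ∈ G.line, {e | OnOrbit G.rot d e ∧ e ∉ G.line}.ncard ≤ 1
  /-- Every vertex off the boundary circle is trivalent. -/
  trivalent : ∀ d, (∀ e, OnOrbit G.rot d e → e ∉ G.line) → {e | OnOrbit G.rot d e}.ncard = 3
  /-- Every edge of the web is directed from one of its ends to the other. -/
  directed : ∀ d, d ∉ G.line → (G.out (G.opp d) ↔ ¬ G.out d)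
  /-- Every vertex is a source or a sink. -/
  source_or_sink : ∀ d e, d ∉ G.line → e ∉ G.line → OnOrbit G.rot d e → (G.out d ↔ G.out e)

/-- Every interior face has at least six edges on its boundary. -/
def IsNonElliptic : Prop := ∀ d, G.IsInteriorFace d → 6 ≤ G.faceLength d

/-- An irreducible (reduced) web: a non-elliptic web. -/
def IsIrreducibleWeb : Prop := G.IsWeb ∧ G.IsNonElliptic

/-- Every marked point of the boundary circle is the end of an edge of the web. -/
def NoIsolatedPoint : Prop := ∀ d ∈ G.line, ∃ e, OnOrbit G.rot d e ∧ e ∉ G.line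

end DiskGraph

/-! # The m-diagram -/

namespace MDiagram

/-- The number `j` that the number `i` is joined to by an arc to its left: the largest `k < i` on
the row immediately below the row of `i` that is not already on an arc with another number from the
row of `i`. -/
def partner {N : ℕ} (row : Fin N → ℕ) (i : Fin N) : Option (Fin N) :=
  (Finset.univ.filter fun k : Fin N =>
    k < i ∧ row k + 1 = row i ∧
      ∀ i' : {i' : Fin N // i' < i}, row i' = row i → partner row i' ≠ some k).max
termination_by i.val
decreasing_by all_goals exact Fin.lt_def.1 (Subtype.prop (p := fun k => k < i) _)

variable {N : ℕ} (row : Fin N → ℕ)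

/-- The arcs of the m-diagram.  An arc is the upper semicircle over the segment
`[left, right]` of the boundary line. -/
@[ext]
structure Arc where
  left : Fin N
  right : Fin N
  joined : partner row right = some left

/-- An arc between the bottom row and the one above it. -/
def Arc.IsFirst {row : Fin N → ℕ} (a : Arc row) : Prop := row a.right = 1

/-- The upper semicircle over `[l, r]`. -/
def semicircle (l r : ℝ) : Set (ℝ × ℝ) :=
  {p | 0 ≤ p.2 ∧ (p.1 - (l + r) / 2) ^ 2 + p.2 ^ 2 = ((r - l) / 2) ^ 2}

/-- The crossings of two arcs above the boundary line: `a` starts to the left of `b`, and `b` starts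
under `a` and ends to the right of `a`. -/
@[ext]
structure Crossing where
  a : Arc row
  b : Arc row
  left_lt : a.left < b.left
  lt_right : b.left < a.right
  right_lt : a.right < b.right

/-- The horizontal coordinate of the point where the semicircles over `[l, r]` and `[l', r']`
cross. -/
def crossX (l r l' r' : ℚ) : ℚ := (l' * r' - l * r) / (l' + r' - l - r)

/-- Justification of `Crossing` and `crossX`: two semicircles meet above the boundary line exactly
if their end points interleave, and then the meeting point is over `crossX`. -/
theorem semicircles_meet_iff (l r l' r' : ℚ) (h : l < r) (h' : l' < r') (hl : l < l') (x : ℝ) :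
    (∃ y : ℝ, 0 < y ∧ (x, y) ∈ semicircle l r ∧ (x, y) ∈ semicircle l' r') ↔
      (l' < r ∧ r < r') ∧ x = (crossX l r l' r' : ℝ) := by
  have hR : (l : ℝ) < r := by exact_mod_cast h
  have hR' : (l' : ℝ) < r' := by exact_mod_cast h'
  have hlR : (l : ℝ) < l' := by exact_mod_cast hl
  have e1 : (l' < r) ↔ (l' : ℝ) < r := by exact_mod_cast Iff.rfl
  have e2 : (r < r') ↔ (r : ℝ) < r' := by exact_mod_cast Iff.rfl
  rw [e1, e2]
  simp only [semicircle, Set.mem_ofPred_eq, crossX]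
  push_cast
  generalize (l : ℝ) = l at *
  generalize (r : ℝ) = r at *
  generalize (l' : ℝ) = l' at *
  generalize (r' : ℝ) = r' at *
  constructor
  · rintro ⟨y, hy, ⟨-, h1⟩, -, h2⟩
    have k1 : (x - l) * (r - x) = y ^ 2 := by linarith
    have k2 : (x - l') * (r' - x) = y ^ 2 := by linarith
    have hy2 : 0 < y ^ 2 := by positivity
    have xl : l < x := by
      by_contra hc
      have : (x - l) * (r - x) ≤ 0 := mul_nonpos_of_nonpos_of_nonneg (by linarith) (by linarith)
      linarith
    have xr : x < r := by
      by_contra hc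
      have : (x - l) * (r - x) ≤ 0 := mul_nonpos_of_nonneg_of_nonpos (by linarith) (by linarith)
      linarith
    have xl' : l' < x := by
      by_contra hc
      have : (x - l') * (r' - x) ≤ 0 := mul_nonpos_of_nonpos_of_nonneg (by linarith) (by linarith)
      linarith
    have hrr : r < r' := by
      by_contra hc
      have a1 : (x - l') * (r' - x) ≤ (x - l') * (r - x) :=
        mul_le_mul_of_nonneg_left (by linarith) (by linarith)
      have a2 : (x - l') * (r - x) < (x - l) * (r - x) :=
        mul_lt_mul_of_pos_right (by linarith) (by linarith)
      linarith
    refine ⟨⟨by linarith, hrr⟩, ?_⟩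
    rw [eq_div_iff (by linarith)]
    linarith
  · rintro ⟨⟨h1, h2⟩, hx⟩
    have hd : 0 < l' + r' - l - r := by linarith
    have hx' : x * (l' + r' - l - r) = l' * r' - l * r := by
      rw [hx, div_mul_cancel₀ _ hd.ne']
    have p1 : (x - l) * (l' + r' - l - r) = (l' - l) * (r' - l) := by linarith
    have p2 : (r - x) * (l' + r' - l - r) = (r' - r) * (r - l') := by linarith
    have q1 : 0 < x - l := by
      have : 0 < (x - l) * (l' + r' - l - r) := by
        rw [p1]; exact mul_pos (by linarith) (by linarith)
      exact pos_of_mul_pos_left this hd.le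
    have q2 : 0 < r - x := by
      have : 0 < (r - x) * (l' + r' - l - r) := by
        rw [p2]; exact mul_pos (by linarith) (by linarith)
      exact pos_of_mul_pos_left this hd.le
    have hpos : 0 < (x - l) * (r - x) := mul_pos q1 q2
    have hs : Real.sqrt ((x - l) * (r - x)) ^ 2 = (x - l) * (r - x) := Real.sq_sqrt hpos.le
    exact ⟨Real.sqrt ((x - l) * (r - x)), Real.sqrt_pos.2 hpos,
      ⟨(Real.sqrt_nonneg _), by linarith⟩, (Real.sqrt_nonneg _), by linarith⟩

variable {row}

/-- The horizontal coordinate of a crossing. -/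
def Crossing.x (c : Crossing row) : ℚ :=
  crossX (c.a.left : ℕ) (c.a.right : ℕ) (c.b.left : ℕ) (c.b.right : ℕ)

/-- The four half-edges at a crossing, in counterclockwise order. -/
inductive Quadrant
  | ne
  | nw
  | sw
  | se

/-- The counterclockwise next quadrant. -/
def Quadrant.next : Quadrant → Quadrant
  | .ne => .nw
  | .nw => .sw
  | .sw => .se
  | .se => .ne

/-- The arc containing a given half-edge at a crossing: to the left of the crossing the arc `a` is
the upper one, to the right of the crossing the arc `b` is the upper one. -/
def Crossing.arc (c : Crossing row) : Quadrant → Arc row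
  | .ne => c.b
  | .nw => c.a
  | .sw => c.b
  | .se => c.a

/-- A half-edge at a crossing that points to the right. -/
def Quadrant.IsEast : Quadrant → Prop
  | .ne => True
  | .nw => False
  | .sw => False
  | .se => True

variable (row)

/-- The boundary points of degree two: the right end of an arc and the left end of another. -/
def IsDouble (j : Fin N) : Prop := (∃ a : Arc row, a.right = j) ∧ ∃ b : Arc row, b.left = j

/-- The half-edges of the resolved m-diagram. -/
inductive Half
  /-- on the boundary line at `i`, pointing to the right -/
  | lineE (i : Fin N)
  /-- on the boundary line at `i`, pointing to the left -/
  | lineW (i : Fin N)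
  /-- the lower half of the stem of the `Y` that replaces the double point `j` (pointing up) -/
  | stemBot (j : Fin N) (h : IsDouble row j)
  /-- the upper half of the stem of the `Y` that replaces the double point `j` (pointing down) -/
  | stemTop (j : Fin N) (h : IsDouble row j)
  /-- at the left end of the arc `a` -/
  | arcL (a : Arc row)
  /-- at the right end of the arc `a` -/
  | arcR (a : Arc row)
  /-- one of the four half-edges at the crossing `c` -/
  | cross (c : Crossing row) (q : Quadrant)
  /-- half of the new edge joining the two vertices that replace the crossing `c`: the half at the
  source (`o = true`) or at the sink (`o = false`) -/
  | rung (c : Crossing row) (o : Bool)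

variable {row}

open Classical in
/-- The first half-edge met on the arc `a` on the way to the right, starting over the coordinate
`x`: it belongs to the first crossing on `a` beyond `x` or, if there is none, to the right end. -/
noncomputable def nextOnArc (a : Arc row) (x : ℚ) : Half row :=
  if h : ∃ c : Crossing row, (c.a = a ∨ c.b = a) ∧ x < c.x ∧
      ∀ c' : Crossing row, (c'.a = a ∨ c'.b = a) → x < c'.x → c.x ≤ c'.x then
    .cross h.choose (if h.choose.a = a then .nw else .sw)
  else .arcR a

open Classical in
/-- The first half-edge met on the arc `a` on the way to the left, starting over `x`. -/
noncomputable def prevOnArc (a : Arc row) (x : ℚ) : Half row :=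
  if h : ∃ c : Crossing row, (c.a = a ∨ c.b = a) ∧ c.x < x ∧
      ∀ c' : Crossing row, (c'.a = a ∨ c'.b = a) → c'.x < x → c'.x ≤ c.x then
    .cross h.choose (if h.choose.a = a then .se else .ne)
  else .arcL a

open Classical in
/-- The other half of an edge.  The boundary line is closed up to the boundary circle of a disk by
an edge from its last point to its first. -/
noncomputable def opp : Half row → Half row
  | .lineE i => .lineW (finRotate N i)
  | .lineW i => .lineE ((finRotate N).symm i)
  | .stemBot j h => .stemTop j h
  | .stemTop j h => .stemBot j h
  | .arcL a => nextOnArc a (a.left : ℕ)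
  | .arcR a => prevOnArc a (a.right : ℕ)
  | .cross c q => if q.IsEast then nextOnArc (c.arc q) c.x else prevOnArc (c.arc q) c.x
  | .rung c o => .rung c !o

/-- The direction of the edges: first arcs run from left to right and second arcs from right to
left (so the two arcs of an m run towards its trivalent vertex, and an isolated arc runs from the
bottom row to the middle row), continuing across crossings; stems run away from the boundary. The
new edge at a crossing runs from its source to its sink. -/
def out : Half row → Prop
  | .lineE _ => False
  | .lineW _ => False
  | .stemBot _ _ => True
  | .stemTop _ _ => False
  | .arcL a => a.IsFirst
  | .arcR a => ¬ a.IsFirst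
  | .cross c q => (q.IsEast ↔ (c.arc q).IsFirst)
  | .rung _ o => o = true

open Classical in
/-- The half-edge going up from the boundary point `i` if there is one, and the half-edge on the
boundary line pointing to the left otherwise. -/
noncomputable def upward (i : Fin N) : Half row :=
  if h : IsDouble row i then .stemBot i h
  else if h : ∃ a : Arc row, a.right = i then .arcR h.choose
  else if h : ∃ a : Arc row, a.left = i then .arcL h.choose
  else .lineW i

open Classical in
/-- The counterclockwise next half-edge at the same vertex of the resolved m-diagram.
* At a point of the boundary line the order is right, up, left.
* At the trivalent vertex of an m: the stem, then the right (second) arc, then the left arc.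
* A crossing is replaced by two vertices, a sink that receives the two half-edges directed towards
  the crossing and a source that receives the two half-edges directed away from it, joined by a new
  edge.  So consecutive half-edges at the crossing remain consecutive if they are directed in the
  same way, and are separated by a half of the new edge otherwise. -/
noncomputable def rot : Half row → Half row
  | .lineE i => upward i
  | .lineW i => .lineE i
  | .stemBot j _ => .lineW j
  | .stemTop _ h => .arcL h.2.choose
  | .arcL a => if h : IsDouble row a.left then .arcR h.1.choose else .lineW a.left
  | .arcR a => if h : IsDouble row a.right then .stemTop a.right h else .lineW a.right
  | .cross c q =>
      if out (.cross c q) ↔ out (.cross c q.next) then .cross c q.next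
      else .rung c (decide (out (.cross c q)))
  | .rung c o =>
      -- the two half-edges on top of the crossing, or the two below it
      if out (.cross c .ne) ↔ o = true then .cross c .ne else .cross c .sw

end MDiagram

/-- The resolved m-diagram of a (three-row) standard tableau, as a graph in a disk. -/
noncomputable def StandardTableau.resolvedMDiagram {μ : YoungDiagram} (T : StandardTableau μ) :
    DiskGraph where
  Half := MDiagram.Half T.row
  rot := MDiagram.rot
  opp := MDiagram.opp
  line := {d | ∃ i, d = .lineE i ∨ d = .lineW i}
  out := MDiagram.out

/-! Arcs between the same two rows are nested or disjoint, up to a shared end of the line, so every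
crossing involves one first and one second arc. At a crossing the two half-edges above it are then
directed alike, and so are the two below it. The resolution therefore always inserts a rung between
an upper and a lower vertex, one a source and the other a sink. At a double point the stem and both
arcs run into the trivalent vertex, which is a sink.

In a web, sources and sinks alternate around an interior face, so its length is even
(`IsWeb.even_faceLength`), and only lengths 2 and 4 remain to be excluded. The rightmost point of an
interior face is a crossing `c`, whose rung the face has on its east side
(`exists_rungTop_of_isInteriorFace`). The boundary walk goes down the rung, leaves leftwards along
the lower arc `c.b`, and returns along the upper arc `c.a`. If it closed up after four steps, a
single edge would join the piece of `c.b` to the piece of `c.a`. If that edge lay on an arc, its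
type would differ from the types of both neighbours (`isFirst_rot`), although `c.a` and `c.b` have
different types. If it were a rung, `c.a` and `c.b` would cross twice, contrary to
`Crossing.eq_of_on`. This is `step_four_ne`; it covers bigons too, since 2 divides 4.

Planarity is Euler's formula for the combinatorial map. Vertices and edges are counted by explicit
representatives. Faces are counted by their rightmost points: `exists_face` pushes any half-edge to
the right along its face until a representative is met, and `face_half_injective` separates
representatives by the set `Under` of arcs above a face, which is constant along boundary walks
(`under_step`).

Geometry is made linear by replacing the ordinate `y` with `x ^ 2 + y ^ 2`: semicircles become
chords of a parabola, and all comparisons of arcs become comparisons of affine functions over `ℚ`.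
-/

namespace MDiagram

/-! ### Arcs and crossings as chords of a parabola -/

section Arcs

variable {N : ℕ} {row : Fin N → ℕ}

theorem partner_eq_some {i k : Fin N} (h : partner row i = some k) :
    k < i ∧ row k + 1 = row i ∧ (∀ i' < i, row i' = row i → partner row i' ≠ some k) ∧
      ∀ k', k' < i → row k' + 1 = row i →
        (∀ i' < i, row i' = row i → partner row i' ≠ some k') → k' ≤ k := by
  rw [partner] at h
  have h1 := Finset.mem_of_max h
  simp only [Finset.mem_filter, Finset.mem_univ, true_and, Subtype.forall] at h1
  refine ⟨h1.1, h1.2.1, h1.2.2, fun k' a b c => ?_⟩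
  exact Finset.le_max_of_eq (s := Finset.univ.filter _) (by
    simp only [Finset.mem_filter, Finset.mem_univ, true_and, Subtype.forall]
    exact ⟨a, b, c⟩) h

theorem exists_partner {i k : Fin N} (h1 : k < i) (h2 : row k + 1 = row i)
    (h3 : ∀ i' < i, row i' = row i → partner row i' ≠ some k) :
    ∃ k', partner row i = some k' := by
  rw [partner]
  exact Finset.max_of_mem (a := k) (by
    simp only [Finset.mem_filter, Finset.mem_univ, true_and, Subtype.forall]
    exact ⟨h1, h2, h3⟩)

namespace Arc

theorem left_lt_right (a : Arc row) : a.left < a.right := (partner_eq_some a.joined).1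

theorem row_left (a : Arc row) : row a.left + 1 = row a.right := (partner_eq_some a.joined).2.1

theorem ext_right {a b : Arc row} (h : a.right = b.right) : a = b := by
  have h1 := a.joined
  have h2 := b.joined
  rw [h, h2] at h1
  exact Arc.ext (Option.some.inj h1).symm h

/-- A common left end forces the right ends into the same row; the later of them could not have
chosen a number already taken from that row. -/
theorem ext_left {a b : Arc row} (h : a.left = b.left) : a = b := by
  have hr : row a.right = row b.right := by rw [← a.row_left, ← b.row_left, h]
  rcases lt_trichotomy a.right b.right with h' | h' | h'
  · exact absurd (h ▸ a.joined) ((partner_eq_some b.joined).2.2.1 _ h' hr)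
  · exact ext_right h'
  · exact absurd (h ▸ b.joined) ((partner_eq_some a.joined).2.2.1 _ h' hr.symm)

/-- Arcs between the same two rows do not cross. -/
theorem not_interleaved {a b : Arc row} (hr : row a.right = row b.right)
    (h1 : a.left < b.left) (h2 : b.left < a.right) (h3 : a.right < b.right) : False := by
  -- `b.left` was still free when `a.right` chose its partner, and it is larger than `a.left`,
  -- against maximality. Had it been taken by some `i' < a.right`, the arc so formed would be `b`,
  -- ending before `a.right`.
  refine absurd ((partner_eq_some a.joined).2.2.2 b.left h2 (by rw [hr, b.row_left]) ?_)
    (not_le.2 h1)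
  intro i' hi' _ hp
  have : (⟨b.left, i', hp⟩ : Arc row) = b := ext_left rfl
  rw [← this] at h3
  exact absurd h3 (not_lt.2 hi'.le)

/-- With three rows a right end lies in row 1 or 2, so the type of an arc determines its pair of
rows. -/
theorem isFirst_iff_of_row {a b : Arc row} (h3 : ∀ i, row i ≤ 2) :
    (a.IsFirst ↔ b.IsFirst) ↔ row a.right = row b.right := by
  have := a.row_left
  have := b.row_left
  have := h3 a.right
  have := h3 b.right
  unfold IsFirst
  omega

/-- An arc, seen as a chord of a parabola: the semicircle over `[l, r]` is the set of points
`(x, y)` above the line with `x ^ 2 + y ^ 2 = height x`. -/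
def height (a : Arc row) (x : ℚ) : ℚ :=
  (((a.left : ℕ) : ℚ) + (a.right : ℕ)) * x - ((a.left : ℕ) : ℚ) * (a.right : ℕ)

theorem height_sub_sq (a : Arc row) (x : ℚ) :
    a.height x - x ^ 2 = (x - (a.left : ℕ)) * ((a.right : ℕ) - x) := by
  unfold height; ring

theorem left_lt_right_rat (a : Arc row) : ((a.left : ℕ) : ℚ) < (a.right : ℕ) := by
  exact_mod_cast a.left_lt_right

theorem sq_lt_height {a : Arc row} {x : ℚ} (h1 : ((a.left : ℕ) : ℚ) < x) (h2 : x < (a.right : ℕ)) :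
    x ^ 2 < a.height x := by
  have := a.height_sub_sq x
  have : 0 < (x - (a.left : ℕ)) * ((a.right : ℕ) - x) := mul_pos (by linarith) (by linarith)
  linarith

theorem height_lt_sq_of_lt {a : Arc row} {x : ℚ} (h1 : x < (a.left : ℕ)) :
    a.height x < x ^ 2 := by
  have := a.height_sub_sq x
  have := a.left_lt_right_rat
  have : (x - (a.left : ℕ)) * ((a.right : ℕ) - x) < 0 :=
    mul_neg_of_neg_of_pos (by linarith) (by linarith)
  linarith

theorem height_lt_sq_of_gt {a : Arc row} {x : ℚ} (h1 : ((a.right : ℕ) : ℚ) < x) :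
    a.height x < x ^ 2 := by
  have := a.height_sub_sq x
  have := a.left_lt_right_rat
  have : (x - (a.left : ℕ)) * ((a.right : ℕ) - x) < 0 :=
    mul_neg_of_pos_of_neg (by linarith) (by linarith)
  linarith

theorem height_left (a : Arc row) : a.height (a.left : ℕ) = ((a.left : ℕ) : ℚ) ^ 2 := by
  unfold height; ring

theorem height_right (a : Arc row) : a.height (a.right : ℕ) = ((a.right : ℕ) : ℚ) ^ 2 := by
  unfold height; ring

theorem lt_right_of_sq_lt {a : Arc row} {x : ℚ} (h : x ^ 2 < a.height x) :
    ((a.left : ℕ) : ℚ) < x ∧ x < (a.right : ℕ) := by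
  have h2 := a.height_sub_sq x
  constructor
  · by_contra hc
    rcases (not_lt.1 hc).lt_or_eq with hc | hc
    · linarith [height_lt_sq_of_lt hc]
    · rw [hc, height_left] at h; exact lt_irrefl _ h
  · by_contra hc
    rcases (not_lt.1 hc).lt_or_eq with hc | hc
    · linarith [height_lt_sq_of_gt hc]
    · rw [← hc, height_right] at h; exact lt_irrefl _ h

/-- Distinct arcs between the same two rows have no common point above the line. -/
theorem eq_of_height_eq {a b : Arc row} (hr : row a.right = row b.right) {x : ℚ}
    (ha : x ^ 2 < a.height x) (h : a.height x = b.height x) : a = b := by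
  obtain ⟨a1, a2⟩ := lt_right_of_sq_lt ha
  obtain ⟨b1, b2⟩ := lt_right_of_sq_lt (h ▸ ha)
  -- Both arcs contain `x` and do not interleave, so the one starting further left encloses the
  -- other and is strictly higher.
  have key : ∀ a b : Arc row, row a.right = row b.right → ((a.left : ℕ) : ℚ) < x →
      x < (a.right : ℕ) → ((b.left : ℕ) : ℚ) < x → x < (b.right : ℕ) → a.left < b.left →
      b.height x < a.height x := by
    intro a b hr a1 a2 b1 b2 hl
    have h2 : b.left < a.right := by
      have : ((b.left : ℕ) : ℚ) < (a.right : ℕ) := b1.trans a2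
      exact_mod_cast this
    have h3 : b.right ≤ a.right := by
      by_contra hc
      exact not_interleaved hr hl h2 (not_le.1 hc)
    have h3' : ((b.right : ℕ) : ℚ) ≤ (a.right : ℕ) := by exact_mod_cast h3
    have hl' : ((a.left : ℕ) : ℚ) < (b.left : ℕ) := by exact_mod_cast hl
    have e1 := a.height_sub_sq x
    have e2 := b.height_sub_sq x
    have e3 : (x - (b.left : ℕ)) * ((b.right : ℕ) - x) ≤ (x - (b.left : ℕ)) * ((a.right : ℕ) - x) :=
      mul_le_mul_of_nonneg_left (by linarith) (by linarith)
    have e4 : (x - (b.left : ℕ)) * ((a.right : ℕ) - x) < (x - (a.left : ℕ)) * ((a.right : ℕ) - x) :=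
      mul_lt_mul_of_pos_right (by linarith) (by linarith)
    linarith
  rcases lt_trichotomy a.left b.left with hl | hl | hl
  · exact absurd h (key a b hr a1 a2 b1 b2 hl).ne'
  · exact ext_left hl
  · exact absurd h (key b a hr.symm b1 b2 a1 a2 hl).ne

end Arc

namespace Crossing

variable (c : Crossing row)

theorem denom_pos :
    (0 : ℚ) < (c.b.left : ℕ) + (c.b.right : ℕ) - (c.a.left : ℕ) - (c.a.right : ℕ) := by
  have h1 : ((c.a.left : ℕ) : ℚ) < (c.b.left : ℕ) := by exact_mod_cast c.left_lt
  have h2 : ((c.a.right : ℕ) : ℚ) < (c.b.right : ℕ) := by exact_mod_cast c.right_lt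
  linarith

/-- The difference of two chords is affine and vanishes at the crossing. Its slope is positive
because both ends of `b` lie to the right of those of `a`; hence `a` is higher before the crossing
and `b` after it. -/
theorem height_sub (y : ℚ) : c.b.height y - c.a.height y =
    ((c.b.left : ℕ) + (c.b.right : ℕ) - (c.a.left : ℕ) - (c.a.right : ℕ)) * (y - c.x) := by
  have := c.denom_pos.ne'
  unfold Crossing.x crossX Arc.height
  field_simp
  ring

theorem height_eq : c.a.height c.x = c.b.height c.x := by
  have := c.height_sub c.x
  rw [sub_self, mul_zero] at this
  linarith

theorem height_lt_of_gt {x : ℚ} (h : c.x < x) : c.a.height x < c.b.height x := by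
  have := c.height_sub x
  have := mul_pos c.denom_pos (sub_pos.2 h)
  linarith

theorem height_lt_of_lt {x : ℚ} (h : x < c.x) : c.b.height x < c.a.height x := by
  have := c.height_sub x
  have := mul_pos c.denom_pos (sub_pos.2 h)
  linarith

/-- Over `b.left` the arc `b` is on the boundary line while `a` is strictly above it, so the
crossing comes later. -/
theorem lt_x : ((c.b.left : ℕ) : ℚ) < c.x := by
  by_contra hc
  have h1 : ((c.a.left : ℕ) : ℚ) < (c.b.left : ℕ) := by exact_mod_cast c.left_lt
  have h2 : ((c.b.left : ℕ) : ℚ) < (c.a.right : ℕ) := by exact_mod_cast c.lt_right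
  have h3 := Arc.sq_lt_height h1 h2
  rw [← c.b.height_left] at h3
  rcases (not_lt.1 hc).lt_or_eq with hc | hc
  · linarith [c.height_lt_of_gt hc]
  · rw [← hc, c.height_eq] at h3; exact lt_irrefl _ h3

theorem x_lt : c.x < (c.a.right : ℕ) := by
  by_contra hc
  have h1 : ((c.a.right : ℕ) : ℚ) < (c.b.right : ℕ) := by exact_mod_cast c.right_lt
  have h2 : ((c.b.left : ℕ) : ℚ) < (c.a.right : ℕ) := by exact_mod_cast c.lt_right
  have h3 := Arc.sq_lt_height h2 h1
  rw [← c.a.height_right] at h3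
  rcases (not_lt.1 hc).lt_or_eq with hc | hc
  · linarith [c.height_lt_of_lt hc]
  · rw [hc, c.height_eq] at h3; exact lt_irrefl _ h3

theorem left_a_lt_x : ((c.a.left : ℕ) : ℚ) < c.x :=
  lt_trans (by exact_mod_cast c.left_lt) c.lt_x

theorem x_lt_right_b : c.x < (c.b.right : ℕ) :=
  lt_trans c.x_lt (by exact_mod_cast c.right_lt)

theorem sq_lt : c.x ^ 2 < c.a.height c.x := Arc.sq_lt_height c.left_a_lt_x c.x_lt

theorem a_ne_b : c.a ≠ c.b := fun h => absurd (h ▸ c.left_lt) (lt_irrefl _)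

/-- Non-crossing within a pair of rows: a crossing mixes the two types of arcs, on which the
directions at a resolved crossing depend. -/
theorem row_ne : row c.a.right ≠ row c.b.right := fun h =>
  Arc.not_interleaved h c.left_lt c.lt_right c.right_lt

theorem isFirst_b (h3 : ∀ i, row i ≤ 2) : c.b.IsFirst ↔ ¬ c.a.IsFirst := by
  have := (Arc.isFirst_iff_of_row (a := c.a) (b := c.b) h3).not.2 c.row_ne
  tauto

/-- The crossing is on the arc `a`. -/
def On (a : Arc row) : Prop := c.a = a ∨ c.b = a

variable {c}

theorem On.height {a : Arc row} (h : c.On a) : a.height c.x = c.a.height c.x := by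
  rcases h with rfl | rfl
  · rfl
  · exact c.height_eq.symm

theorem On.left_lt {a : Arc row} (h : c.On a) : ((a.left : ℕ) : ℚ) < c.x := by
  rcases h with rfl | rfl
  · exact c.left_a_lt_x
  · exact c.lt_x

theorem On.lt_right {a : Arc row} (h : c.On a) : c.x < (a.right : ℕ) := by
  rcases h with rfl | rfl
  · exact c.x_lt
  · exact c.x_lt_right_b

/-- Two crossings at the same point are equal. -/
theorem eq_of_point_eq {c' : Crossing row} (h3 : ∀ i, row i ≤ 2) (hx : c.x = c'.x)
    (hy : c.a.height c.x = c'.a.height c.x) : c = c' := by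
  have r1 := c.isFirst_b h3
  have r2 := c'.isFirst_b h3
  have e1 := c.height_eq
  have e2 := c'.height_eq
  have s1 := c.sq_lt
  rw [← hx] at e2
  by_cases h : c.a.IsFirst ↔ c'.a.IsFirst
  · have h' : c.b.IsFirst ↔ c'.b.IsFirst := by tauto
    rw [Arc.isFirst_iff_of_row h3] at h h'
    exact Crossing.ext (Arc.eq_of_height_eq h s1 hy)
      (Arc.eq_of_height_eq h' (e1 ▸ s1) (by rw [← e1, hy, e2]))
  -- If the types match crosswise, the two crossings have the same arcs with roles exchanged, which
  -- the order of the left ends forbids.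
  · have h1 : c.a.IsFirst ↔ c'.b.IsFirst := by tauto
    have h2 : c.b.IsFirst ↔ c'.a.IsFirst := by tauto
    rw [Arc.isFirst_iff_of_row h3] at h1 h2
    have k1 := Arc.eq_of_height_eq h1 s1 (by rw [hy, e2])
    have k2 := Arc.eq_of_height_eq h2 (e1 ▸ s1) (by rw [← e1, hy])
    have := c.left_lt
    rw [k1, k2] at this
    exact absurd this (not_lt.2 c'.left_lt.le)

theorem On.eq_of_x_eq {c' : Crossing row} (h3 : ∀ i, row i ≤ 2) {a : Arc row} (h : c.On a)
    (h' : c'.On a) (hx : c.x = c'.x) : c = c' :=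
  eq_of_point_eq h3 hx (by rw [← h.height, hx, h'.height])

/-- The left ends decide which arc plays the role of `a`, so the unordered pair of arcs determines
the crossing: two arcs cross at most once. This rules out quadrilaterals with two rungs. -/
theorem eq_of_on {c' : Crossing row} (h1 : c'.On c.a) (h2 : c'.On c.b) : c' = c := by
  rcases h1 with h1 | h1 <;> rcases h2 with h2 | h2
  · exact absurd (h1.symm.trans h2) c.a_ne_b
  · exact Crossing.ext h1 h2
  · have := c'.left_lt
    rw [h1, h2] at this
    exact absurd this (not_lt.2 c.left_lt.le)
  · exact absurd (h1.symm.trans h2) c.a_ne_b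

end Crossing

/-- Two arcs of equal height above the boundary line cross there. -/
theorem exists_crossing {a e : Arc row} (hne : e ≠ a) {x : ℚ} (h1 : ((a.left : ℕ) : ℚ) < x)
    (h2 : x < (a.right : ℕ)) (h : e.height x = a.height x) :
    ∃ c : Crossing row, c.On a ∧ c.On e ∧ c.x = x := by
  have key : ∀ a e : Arc row, a.left < e.left → x ^ 2 < a.height x → x ^ 2 < e.height x →
      e.height x = a.height x → ∃ c : Crossing row, c.On a ∧ c.On e ∧ c.x = x := by
    intro a e hl ha he h
    obtain ⟨a1, a2⟩ := Arc.lt_right_of_sq_lt ha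
    obtain ⟨b1, b2⟩ := Arc.lt_right_of_sq_lt he
    have hl' : ((a.left : ℕ) : ℚ) < (e.left : ℕ) := by exact_mod_cast hl
    have k1 : e.left < a.right := by
      have : ((e.left : ℕ) : ℚ) < (a.right : ℕ) := b1.trans a2
      exact_mod_cast this
    have k2 : a.right < e.right := by
      have : ((a.right : ℕ) : ℚ) < (e.right : ℕ) := by
        by_contra hc
        have e1 := a.height_sub_sq x
        have e2 := e.height_sub_sq x
        have e3 : (x - (e.left : ℕ)) * ((e.right : ℕ) - x) ≤
            (x - (e.left : ℕ)) * ((a.right : ℕ) - x) :=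
          mul_le_mul_of_nonneg_left (by linarith) (by linarith)
        have e4 : (x - (e.left : ℕ)) * ((a.right : ℕ) - x) <
            (x - (a.left : ℕ)) * ((a.right : ℕ) - x) :=
          mul_lt_mul_of_pos_right (by linarith) (by linarith)
        linarith
      exact_mod_cast this
    let c : Crossing row := ⟨a, e, hl, k1, k2⟩
    refine ⟨c, Or.inl rfl, Or.inr rfl, ?_⟩
    have := c.height_sub x
    change e.height x - a.height x = _ at this
    rw [h, sub_self, eq_comm, mul_eq_zero] at this
    rcases this with h' | h'
    · exact absurd h' c.denom_pos.ne'
    · linarith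
  have ha := Arc.sq_lt_height h1 h2
  have he := h ▸ ha
  rcases lt_trichotomy a.left e.left with hl | hl | hl
  · exact key a e hl ha he h
  · exact absurd (Arc.ext_left hl.symm) hne
  · obtain ⟨c, h1, h2, h3⟩ := key e a hl he ha h.symm
    exact ⟨c, h2, h1, h3⟩

end Arcs

/-! ### Half-edges and the edge involution -/

section Halves

variable {N : ℕ} {row : Fin N → ℕ}

theorem IsDouble.exists_left {j : Fin N} (h : IsDouble row j) : ∃ b : Arc row, b.left = j := h.2

instance : Finite (Arc row) := Finite.of_injective Arc.right fun _ _ => Arc.ext_right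

instance : Finite (Crossing row) :=
  Finite.of_injective (fun c => (c.a, c.b)) fun _ _ h =>
    Crossing.ext (congrArg Prod.fst h) (congrArg Prod.snd h)

namespace Half

/-- The arc that a half-edge lies on. -/
def arc? : Half row → Option (Arc row)
  | .arcL a => some a
  | .arcR a => some a
  | .cross c q => some (c.arc q)
  | _ => none

/-- The horizontal coordinate of the vertex that a half-edge is based at. -/
def pos : Half row → ℚ
  | .lineE i => (i : ℕ)
  | .lineW i => (i : ℕ)
  | .stemBot j _ => (j : ℕ)
  | .stemTop j _ => (j : ℕ)
  | .arcL a => (a.left : ℕ)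
  | .arcR a => (a.right : ℕ)
  | .cross c _ => c.x
  | .rung c _ => c.x

/-- One of the two halves of each edge: the one pointing to the right on the boundary line and on
arcs, the lower half of a stem and the source half of a rung. -/
def East : Half row → Prop
  | .lineE _ => True
  | .lineW _ => False
  | .stemBot _ _ => True
  | .stemTop _ _ => False
  | .arcL _ => True
  | .arcR _ => False
  | .cross _ q => q.IsEast
  | .rung _ o => o = true

theorem arc?_cross_on {c : Crossing row} {q : Quadrant} {a : Arc row}
    (h : (cross c q).arc? = some a) : c.On a := by
  cases q <;> simp [arc?, Crossing.arc] at h <;> simp [Crossing.On, h]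

theorem east_cases {d : Half row} {a : Arc row} (h : d.arc? = some a) (hd : d.East) :
    d = arcL a ∨ ∃ c : Crossing row, c.On a ∧ d.pos = c.x := by
  cases d with
  | arcL b => simp [arc?] at h; simp [h]
  | arcR b => simp [East] at hd
  | cross c q => exact Or.inr ⟨c, arc?_cross_on h, rfl⟩
  | _ => simp [arc?] at h

theorem west_cases {d : Half row} {a : Arc row} (h : d.arc? = some a) (hd : ¬ d.East) :
    d = arcR a ∨ ∃ c : Crossing row, c.On a ∧ d.pos = c.x := by
  cases d with
  | arcR b => simp [arc?] at h; simp [h]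
  | arcL b => simp [East] at hd
  | cross c q => exact Or.inr ⟨c, arc?_cross_on h, rfl⟩
  | _ => simp [arc?] at h

theorem left_le_pos {d : Half row} {a : Arc row} (h : d.arc? = some a) :
    ((a.left : ℕ) : ℚ) ≤ d.pos := by
  by_cases hd : d.East
  · rcases east_cases h hd with rfl | ⟨c, hc, hp⟩
    · exact le_rfl
    · exact hp ▸ hc.left_lt.le
  · rcases west_cases h hd with rfl | ⟨c, hc, hp⟩
    · exact a.left_lt_right_rat.le
    · exact hp ▸ hc.left_lt.le

theorem pos_le_right {d : Half row} {a : Arc row} (h : d.arc? = some a) :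
    d.pos ≤ (a.right : ℕ) := by
  by_cases hd : d.East
  · rcases east_cases h hd with rfl | ⟨c, hc, hp⟩
    · exact a.left_lt_right_rat.le
    · exact hp ▸ hc.lt_right.le
  · rcases west_cases h hd with rfl | ⟨c, hc, hp⟩
    · exact le_rfl
    · exact hp ▸ hc.lt_right.le

theorem pos_lt_right {d : Half row} {a : Arc row} (h : d.arc? = some a) (hd : d.East) :
    d.pos < (a.right : ℕ) := by
  rcases east_cases h hd with rfl | ⟨c, hc, hp⟩
  · exact a.left_lt_right_rat
  · exact hp ▸ hc.lt_right

theorem left_lt_pos {d : Half row} {a : Arc row} (h : d.arc? = some a) (hd : ¬ d.East) :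
    ((a.left : ℕ) : ℚ) < d.pos := by
  rcases west_cases h hd with rfl | ⟨c, hc, hp⟩
  · exact a.left_lt_right_rat
  · exact hp ▸ hc.left_lt

/-- A half-edge on an arc is determined by its base point and its direction. -/
theorem ext_arc (h3 : ∀ i, row i ≤ 2) {d e : Half row} {a : Arc row} (hd : d.arc? = some a)
    (he : e.arc? = some a) (hE : d.East ↔ e.East) (hp : d.pos = e.pos) : d = e := by
  cases d with
  | arcL b =>
    have hE' : e.East := hE.1 trivial
    obtain rfl : b = a := by simpa [arc?] using hd
    rcases east_cases he hE' with rfl | ⟨c, hc, hq⟩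
    · rfl
    · rw [hq] at hp
      exact absurd hp hc.left_lt.ne
  | arcR b =>
    have hE' : ¬ e.East := fun h => hE.2 h
    obtain rfl : b = a := by simpa [arc?] using hd
    rcases west_cases he hE' with rfl | ⟨c, hc, hq⟩
    · rfl
    · rw [hq] at hp
      exact absurd hp hc.lt_right.ne'
  | cross c q =>
    have hc := arc?_cross_on hd
    cases e with
    | arcL b =>
      obtain rfl : b = a := by simpa [arc?] using he
      exact absurd hp hc.left_lt.ne'
    | arcR b =>
      obtain rfl : b = a := by simpa [arc?] using he
      exact absurd hp hc.lt_right.ne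
    | cross c' q' =>
      obtain rfl := hc.eq_of_x_eq h3 (arc?_cross_on he) hp
      have h := hd.trans he.symm
      have h1 := c.a_ne_b
      cases q <;> cases q' <;> simp_all [arc?, Crossing.arc, East, Quadrant.IsEast]
    | _ => simp [arc?] at he
  | _ => simp [arc?] at hd

end Half

/-- Removes the choice from `nextOnArc`: by `Half.ext_arc`, when rows are at most 2, the arc, the
direction and the absence of crossings in between pin down the half-edge. -/
theorem nextOnArc_spec (a : Arc row) {x : ℚ} (hx : x < (a.right : ℕ)) :
    (nextOnArc a x).arc? = some a ∧ ¬ (nextOnArc a x).East ∧ x < (nextOnArc a x).pos ∧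
      ∀ c : Crossing row, c.On a → x < c.x → (nextOnArc a x).pos ≤ c.x := by
  unfold nextOnArc
  split_ifs with h h'
  · refine ⟨?_, ?_, h.choose_spec.2.1, h.choose_spec.2.2⟩
    · simpa [Half.arc?, Crossing.arc] using h'
    · simp [Half.East, Quadrant.IsEast]
  · refine ⟨?_, ?_, h.choose_spec.2.1, h.choose_spec.2.2⟩
    · simpa [Half.arc?, Crossing.arc] using h.choose_spec.1.resolve_left h'
    · simp [Half.East, Quadrant.IsEast]
  · refine ⟨rfl, by simp [Half.East], hx, fun c hc hxc => ?_⟩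
    -- There are finitely many crossings, so if any lay beyond `x` there would be a nearest one.
    refine absurd ?_ h
    obtain ⟨c', hc', hmin⟩ := Set.exists_min_image {c : Crossing row | c.On a ∧ x < c.x}
      Crossing.x (Set.toFinite _) ⟨c, hc, hxc⟩
    exact ⟨c', hc'.1, hc'.2, fun c'' h1 h2 => hmin c'' ⟨h1, h2⟩⟩

theorem prevOnArc_spec (a : Arc row) {x : ℚ} (hx : ((a.left : ℕ) : ℚ) < x) :
    (prevOnArc a x).arc? = some a ∧ (prevOnArc a x).East ∧ (prevOnArc a x).pos < x ∧
      ∀ c : Crossing row, c.On a → c.x < x → c.x ≤ (prevOnArc a x).pos := by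
  unfold prevOnArc
  split_ifs with h h'
  · refine ⟨?_, ?_, h.choose_spec.2.1, h.choose_spec.2.2⟩
    · simpa [Half.arc?, Crossing.arc] using h'
    · simp [Half.East, Quadrant.IsEast]
  · refine ⟨?_, ?_, h.choose_spec.2.1, h.choose_spec.2.2⟩
    · simpa [Half.arc?, Crossing.arc] using h.choose_spec.1.resolve_left h'
    · simp [Half.East, Quadrant.IsEast]
  · refine ⟨rfl, by simp [Half.East], hx, fun c hc hxc => ?_⟩
    refine absurd ?_ h
    obtain ⟨c', hc', hmax⟩ := Set.exists_max_image {c : Crossing row | c.On a ∧ c.x < x}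
      Crossing.x (Set.toFinite _) ⟨c, hc, hxc⟩
    exact ⟨c', hc'.1, hc'.2, fun c'' h1 h2 => hmax c'' ⟨h1, h2⟩⟩

theorem opp_of_east {d : Half row} {a : Arc row} (h : d.arc? = some a) (hd : d.East) :
    opp d = nextOnArc a d.pos := by
  cases d <;> simp_all [Half.arc?, Half.East, opp, Half.pos]

theorem opp_of_west {d : Half row} {a : Arc row} (h : d.arc? = some a) (hd : ¬ d.East) :
    opp d = prevOnArc a d.pos := by
  cases d <;> simp_all [Half.arc?, Half.East, opp, Half.pos]

theorem opp_east_spec {d : Half row} {a : Arc row} (h : d.arc? = some a) (hd : d.East) :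
    (opp d).arc? = some a ∧ ¬ (opp d).East ∧ d.pos < (opp d).pos ∧
      ∀ c : Crossing row, c.On a → d.pos < c.x → (opp d).pos ≤ c.x := by
  rw [opp_of_east h hd]
  exact nextOnArc_spec a (Half.pos_lt_right h hd)

theorem opp_west_spec {d : Half row} {a : Arc row} (h : d.arc? = some a) (hd : ¬ d.East) :
    (opp d).arc? = some a ∧ (opp d).East ∧ (opp d).pos < d.pos ∧
      ∀ c : Crossing row, c.On a → c.x < d.pos → c.x ≤ (opp d).pos := by
  rw [opp_of_west h hd]
  exact prevOnArc_spec a (Half.left_lt_pos h hd)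

theorem arc?_opp {d : Half row} {a : Arc row} (h : d.arc? = some a) : (opp d).arc? = some a := by
  by_cases hd : d.East
  · exact (opp_east_spec h hd).1
  · exact (opp_west_spec h hd).1

/-- On an arc, neither of the two moves skips a crossing, so moving to the neighbour and back
returns to the same coordinate; with arc and direction this identifies the half-edge. -/
theorem opp_opp (h3 : ∀ i, row i ≤ 2) (d : Half row) : opp (opp d) = d := by
  rcases hda : d.arc? with _ | a
  · cases d with
    | lineE i => exact congrArg Half.lineE ((finRotate N).symm_apply_apply i)
    | lineW i => exact congrArg Half.lineW ((finRotate N).apply_symm_apply i)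
    | rung c o => simp [opp]
    | _ => first | rfl | simp [Half.arc?] at hda
  by_cases hd : d.East
  · obtain ⟨e1, e2, e4, e5⟩ := opp_east_spec hda hd
    obtain ⟨f1, f2, f4, f5⟩ := opp_west_spec e1 e2
    refine Half.ext_arc h3 f1 hda (iff_of_true f2 hd) (le_antisymm ?_ ?_)
    · rcases Half.east_cases f1 f2 with h | ⟨c, hc, hp⟩
      · rw [h]; exact Half.left_le_pos hda
      · by_contra hlt
        rw [hp] at hlt f4
        exact absurd (e5 c hc (not_le.1 hlt)) (not_le.2 f4)
    · rcases Half.east_cases hda hd with h | ⟨c, hc, hp⟩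
      · conv_lhs => rw [h]
        exact Half.left_le_pos f1
      · rw [hp]; exact f5 c hc (hp ▸ e4)
  · obtain ⟨e1, e2, e4, e5⟩ := opp_west_spec hda hd
    obtain ⟨f1, f2, f4, f5⟩ := opp_east_spec e1 e2
    refine Half.ext_arc h3 f1 hda (iff_of_false f2 hd) (le_antisymm ?_ ?_)
    · rcases Half.west_cases hda hd with h | ⟨c, hc, hp⟩
      · conv_rhs => rw [h]
        exact Half.pos_le_right f1
      · rw [hp]; exact f5 c hc (hp ▸ e4)
    · rcases Half.west_cases f1 f2 with h | ⟨c, hc, hp⟩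
      · rw [h]; exact Half.pos_le_right hda
      · by_contra hlt
        rw [hp] at hlt f4
        exact absurd (e5 c hc (not_le.1 hlt)) (not_le.2 f4)

theorem east_opp (d : Half row) : (opp d).East ↔ ¬ d.East := by
  rcases hda : d.arc? with _ | a
  · cases d <;> simp_all [Half.arc?, opp, Half.East]
  by_cases hd : d.East
  · simpa [hd] using (opp_east_spec hda hd).2.1
  · simpa [hd] using (opp_west_spec hda hd).2.1

theorem opp_ne (d : Half row) : opp d ≠ d := fun h => by
  have := east_opp d
  rw [h] at this
  tauto

/-- The direction of an edge, in terms of the arc it lies on. -/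
theorem out_of_arc? {d : Half row} {a : Arc row} (h : d.arc? = some a) :
    out d ↔ (d.East ↔ a.IsFirst) := by
  cases d <;> simp_all [Half.arc?, out, Half.East]

theorem out_opp {d : Half row} (hd : ¬ ∃ i, d = .lineE i ∨ d = .lineW i) :
    out (opp d) ↔ ¬ out d := by
  rcases hda : d.arc? with _ | a
  · cases d <;> simp_all [Half.arc?, opp, out]
  rw [out_of_arc? hda, out_of_arc? (arc?_opp hda), east_opp]
  tauto

end Halves

end MDiagram

namespace DiskGraph

/-! ### Orbits of a self-map -/

section Orbits

variable {α : Type} {f : α → α}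

theorem OnOrbit.refl (d : α) : OnOrbit f d d := ⟨0, rfl⟩

theorem OnOrbit.step (d : α) : OnOrbit f d (f d) := ⟨1, rfl⟩

theorem OnOrbit.trans {d e g : α} (h1 : OnOrbit f d e) (h2 : OnOrbit f e g) : OnOrbit f d g := by
  obtain ⟨m, rfl⟩ := h1
  obtain ⟨n, rfl⟩ := h2
  exact ⟨n + m, Function.iterate_add_apply f n m d⟩

theorem OnOrbit.symm [Finite α] (hf : Function.Injective f) {d e : α} (h : OnOrbit f d e) :
    OnOrbit f e d := by
  obtain ⟨n, rfl⟩ := h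
  obtain ⟨p, hp, hd⟩ := hf.mem_periodicPts d
  -- With the `n` steps already made this totals `n * p`, a multiple of the period `p`.
  refine ⟨n * p - n, ?_⟩
  rw [← Function.iterate_add_apply, Nat.sub_add_cancel (Nat.le_mul_of_pos_right n hp)]
  exact hd.const_mul n

theorem OnOrbit.invariant {β : Type} {g : α → β} (hg : ∀ d, g (f d) = g d) {d e : α}
    (h : OnOrbit f d e) : g e = g d := by
  obtain ⟨n, rfl⟩ := h
  induction n with
  | zero => rfl
  | succ n ih => rw [Function.iterate_succ_apply', hg, ih]

/-- The number of orbits is the number of elements of a system of representatives. -/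
theorem numOrbits_eq_card [Finite α] (hf : Function.Injective f) {M : Type} (m : M → α)
    (hm : ∀ d, ∃ x, OnOrbit f (m x) d) (hinj : ∀ x y, OnOrbit f (m x) (m y) → x = y) :
    numOrbits f = Nat.card M := by
  have h : (Set.range fun d => {e | OnOrbit f d e}) =
      Set.range fun x => {e | OnOrbit f (m x) e} := by
    ext s
    constructor
    · rintro ⟨d, rfl⟩
      obtain ⟨x, hx⟩ := hm d
      exact ⟨x, Set.ext fun e => ⟨fun h => (hx.symm hf).trans h, fun h => hx.trans h⟩⟩
    · rintro ⟨x, rfl⟩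
      exact ⟨m x, rfl⟩
  rw [numOrbits, h, ← Nat.card_coe_set_eq]
  refine (Nat.card_congr (Equiv.ofInjective _ fun x y hxy => ?_)).symm
  refine hinj x y ?_
  have h : {e | OnOrbit f (m x) e} = {e | OnOrbit f (m y) e} := hxy
  have : m y ∈ {e | OnOrbit f (m x) e} := h ▸ OnOrbit.refl _
  exact this

theorem ncard_orbit_eq_three {d : α} (h3 : f (f (f d)) = d) (h1 : f d ≠ d) :
    {e | OnOrbit f d e}.ncard = 3 := by
  have h : {e | OnOrbit f d e} = {d, f d, f (f d)} := by
    ext e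
    constructor
    · rintro ⟨n, rfl⟩
      induction n with
      | zero => simp
      | succ n ih =>
        rw [Function.iterate_succ_apply']
        rcases ih with h | h | h <;> rw [h] <;> simp [h3]
    · rintro (rfl | rfl | rfl)
      exacts [⟨0, rfl⟩, ⟨1, rfl⟩, ⟨2, rfl⟩]
  have h2 : f (f d) ≠ d := fun h => h1 (by rw [h] at h3; exact h3)
  have h4 : f (f d) ≠ f d := fun h => h2 (by rw [h] at h3; exact h3)
  rw [h, Set.ncard_eq_three]
  exact ⟨_, _, _, h1.symm, h2.symm, h4.symm, rfl⟩

end Orbits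

end DiskGraph

namespace MDiagram

/-! ### The rotation at the vertices -/

section Rotation

variable {N : ℕ} {row : Fin N → ℕ}

theorem isDouble_of_eq {a b : Arc row} (h : a.right = b.left) : IsDouble row b.left :=
  ⟨⟨a, h⟩, b, rfl⟩

theorem isDouble_right {a b : Arc row} (h : a.right = b.left) : IsDouble row a.right :=
  ⟨⟨a, rfl⟩, b, h.symm⟩

/-- A double point has a row below it and a row above it, so the arc starting there is not a first
arc. -/
theorem not_isFirst_of_isDouble {b : Arc row} (h : IsDouble row b.left) : ¬ b.IsFirst := by
  obtain ⟨a, ha⟩ := h.1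
  have h1 := a.row_left
  have h2 := b.row_left
  rw [ha] at h1
  unfold Arc.IsFirst
  omega

theorem isFirst_of_isDouble (h3 : ∀ i, row i ≤ 2) {a : Arc row} (h : IsDouble row a.right) :
    a.IsFirst := by
  obtain ⟨b, hb⟩ := h.2
  have h1 := a.row_left
  have h2 := b.row_left
  rw [hb] at h2
  have := h3 b.right
  unfold Arc.IsFirst
  omega

theorem upward_of_isDouble {j : Fin N} (h : IsDouble row j) : upward j = Half.stemBot j h := by
  simp [upward, h]

theorem upward_right {a : Arc row} (h : ¬ IsDouble row a.right) : upward a.right = Half.arcR a := by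
  have h' : ∃ b : Arc row, b.right = a.right := ⟨a, rfl⟩
  rw [upward, dif_neg h, dif_pos h', Arc.ext_right h'.choose_spec]

theorem upward_left {a : Arc row} (h : ¬ IsDouble row a.left) : upward a.left = Half.arcL a := by
  have h' : ∃ b : Arc row, b.left = a.left := ⟨a, rfl⟩
  rw [upward, dif_neg h, dif_neg (fun h2 => h ⟨h2, h'⟩), dif_pos h', Arc.ext_left h'.choose_spec]

theorem upward_isolated {i : Fin N} (h1 : ¬ ∃ a : Arc row, a.right = i)
    (h2 : ¬ ∃ a : Arc row, a.left = i) : upward (row := row) i = Half.lineW i := by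
  rw [upward, dif_neg (fun h => h1 h.1), dif_neg h1, dif_neg h2]

theorem upward_cases (i : Fin N) :
    (∃ h : IsDouble row i, upward i = Half.stemBot i h) ∨
    (∃ a : Arc row, a.right = i ∧ ¬ IsDouble row i ∧ upward i = Half.arcR a) ∨
    (∃ a : Arc row, a.left = i ∧ ¬ IsDouble row i ∧ upward i = Half.arcL a) ∨
    ((¬ ∃ a : Arc row, a.right = i) ∧ (¬ ∃ a : Arc row, a.left = i) ∧
      upward (row := row) i = Half.lineW i) := by
  by_cases hd : IsDouble row i
  · exact Or.inl ⟨hd, upward_of_isDouble hd⟩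
  by_cases h1 : ∃ a : Arc row, a.right = i
  · obtain ⟨a, rfl⟩ := h1
    exact Or.inr (Or.inl ⟨a, rfl, hd, upward_right hd⟩)
  by_cases h2 : ∃ a : Arc row, a.left = i
  · obtain ⟨a, rfl⟩ := h2
    exact Or.inr (Or.inr (Or.inl ⟨a, rfl, hd, upward_left hd⟩))
  · exact Or.inr (Or.inr (Or.inr ⟨h1, h2, upward_isolated h1 h2⟩))

theorem rot_stemTop {b : Arc row} {j : Fin N} (h : IsDouble row j) (hb : b.left = j) :
    rot (.stemTop j h) = .arcL b := by
  simp only [rot]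
  exact congrArg _ (Arc.ext_left (h.2.choose_spec.trans hb.symm))

theorem rot_arcL {a b : Arc row} (h : a.right = b.left) : rot (.arcL b) = .arcR a := by
  have h' := isDouble_of_eq h
  rw [rot, dif_pos h']
  exact congrArg _ (Arc.ext_right (h'.1.choose_spec.trans h.symm))

theorem rot_arcL_of_not {b : Arc row} (h : ¬ IsDouble row b.left) :
    rot (.arcL b) = .lineW b.left := by
  rw [rot, dif_neg h]

theorem rot_arcR {a : Arc row} (h : IsDouble row a.right) :
    rot (.arcR a) = .stemTop a.right h := by
  rw [rot, dif_pos h]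

theorem rot_arcR_of_not {a : Arc row} (h : ¬ IsDouble row a.right) :
    rot (.arcR a) = .lineW a.right := by
  rw [rot, dif_neg h]

open Classical in
/-- The half at the upper vertex of the new edge at a crossing. -/
noncomputable def Crossing.rungTop (c : Crossing row) : Half row :=
  .rung c (decide (out (.cross c .ne)))

open Classical in
/-- The half at the lower vertex of the new edge at a crossing. -/
noncomputable def Crossing.rungBot (c : Crossing row) : Half row :=
  .rung c !(decide (out (.cross c .ne)))

/-- Whether the source of a rung is its upper or lower end depends on the types of the arcs. Naming
the halves by position makes the rotation formulas below uniform. -/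
theorem rung_cases (c : Crossing row) (o : Bool) :
    .rung c o = c.rungTop ∨ .rung c o = c.rungBot := by
  unfold Crossing.rungTop Crossing.rungBot
  cases o <;> by_cases h : out (.cross c .ne) <;> simp [h]

theorem opp_rungTop (c : Crossing row) : opp c.rungTop = c.rungBot := rfl

theorem opp_rungBot (c : Crossing row) : opp c.rungBot = c.rungTop := by
  simp [Crossing.rungBot, Crossing.rungTop, opp]

theorem rot_rungTop (c : Crossing row) : rot c.rungTop = .cross c .ne := by
  simp [Crossing.rungTop, rot]

theorem rot_rungBot (c : Crossing row) : rot c.rungBot = .cross c .sw := by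
  simp [Crossing.rungBot, rot]

/-- From `ne` to `nw` both the horizontal direction and the type of the arc change, so the
orientation does not. Hence the two upper half-edges share a vertex. -/
theorem out_nw (h3 : ∀ i, row i ≤ 2)
    (c : Crossing row) : out (.cross c .nw) ↔ out (.cross c .ne) := by
  have := c.isFirst_b h3
  simp only [out, Quadrant.IsEast, Crossing.arc]
  tauto

theorem out_sw (h3 : ∀ i, row i ≤ 2)
    (c : Crossing row) : out (.cross c .sw) ↔ ¬ out (.cross c .ne) := by
  have := c.isFirst_b h3
  simp only [out, Quadrant.IsEast, Crossing.arc]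
  tauto

theorem out_se (h3 : ∀ i, row i ≤ 2)
    (c : Crossing row) : out (.cross c .se) ↔ ¬ out (.cross c .ne) := by
  have := c.isFirst_b h3
  simp only [out, Quadrant.IsEast, Crossing.arc]
  tauto

theorem rot_ne (h3 : ∀ i, row i ≤ 2) (c : Crossing row) : rot (.cross c .ne) = .cross c .nw := by
  rw [rot, if_pos]
  · rfl
  · exact (out_nw h3 c).symm

theorem rot_sw (h3 : ∀ i, row i ≤ 2) (c : Crossing row) : rot (.cross c .sw) = .cross c .se := by
  rw [rot, if_pos]
  · rfl
  · rw [out_sw h3, Quadrant.next, out_se h3]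

theorem rot_nw (h3 : ∀ i, row i ≤ 2) (c : Crossing row) : rot (.cross c .nw) = c.rungTop := by
  rw [rot, if_neg, Crossing.rungTop]
  · simp [out_nw h3]
  · rw [out_nw h3, Quadrant.next, out_sw h3]
    tauto

theorem rot_se (h3 : ∀ i, row i ≤ 2) (c : Crossing row) : rot (.cross c .se) = c.rungBot := by
  rw [rot, if_neg, Crossing.rungBot]
  · by_cases h : out (.cross c .ne) <;> simp [out_se h3, h]
  · rw [out_se h3, Quadrant.next]
    tauto

end Rotation

end MDiagram

open DiskGraph
namespace MDiagram

/-! ### Counting vertices and edges -/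

section Vertices

variable {N : ℕ} {row : Fin N → ℕ}

/-- The type of vertices: the points of the boundary line, the trivalent vertices of the double
points, and the upper (`true`) and lower (`false`) vertices of the crossings. -/
abbrev Vertex (row : Fin N → ℕ) : Type :=
  Fin N ⊕ {j : Fin N // IsDouble row j} ⊕ Crossing row × Bool

/-- The edges, by the kinds of their distinguished halves. -/
abbrev Edge (row : Fin N → ℕ) : Type :=
  Fin N ⊕ {j : Fin N // IsDouble row j} ⊕ Arc row ⊕ Crossing row × Fin 3

/-- A half of an edge. -/
def Edge.half : Edge row → Half row
  | .inl i => .lineE i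
  | .inr (.inl j) => .stemBot j.1 j.2
  | .inr (.inr (.inl a)) => .arcL a
  | .inr (.inr (.inr (c, 0))) => .cross c .ne
  | .inr (.inr (.inr (c, 1))) => .cross c .se
  | .inr (.inr (.inr (c, 2))) => .rung c true

theorem Edge.half_east (x : Edge row) : x.half.East := by
  match x with
  | .inl i => trivial
  | .inr (.inl j) => trivial
  | .inr (.inr (.inl a)) => trivial
  | .inr (.inr (.inr (c, 0))) => trivial
  | .inr (.inr (.inr (c, 1))) => trivial
  | .inr (.inr (.inr (c, 2))) => rfl

theorem Edge.half_surjective {d : Half row} (hd : d.East) : ∃ x : Edge row, x.half = d := by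
  cases d with
  | lineE i => exact ⟨.inl i, rfl⟩
  | stemBot j h => exact ⟨.inr (.inl ⟨j, h⟩), rfl⟩
  | arcL a => exact ⟨.inr (.inr (.inl a)), rfl⟩
  | cross c q =>
    cases q with
    | ne => exact ⟨.inr (.inr (.inr (c, 0))), rfl⟩
    | se => exact ⟨.inr (.inr (.inr (c, 1))), rfl⟩
    | _ => exact absurd hd id
  | rung c o =>
    obtain rfl : o = true := hd
    exact ⟨.inr (.inr (.inr (c, 2))), rfl⟩
  | _ => exact absurd hd id

theorem Edge.half_injective : Function.Injective (Edge.half (row := row)) := by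
  rintro (i | j | a | ⟨c, k⟩) (i' | j' | a' | ⟨c', k'⟩) h
  case inr.inr.inr.inr.inr.inr => fin_cases k <;> fin_cases k' <;> simp_all [Edge.half]
  case inr.inl.inr.inl => simp only [Edge.half, Half.stemBot.injEq] at h; simp [Subtype.ext h]
  all_goals first
    | (fin_cases k; all_goals simp [Edge.half] at h)
    | (fin_cases k'; all_goals simp [Edge.half] at h)
    | simp_all [Edge.half]

/-- The vertex that a half-edge is based at. -/
noncomputable def Half.vertex : Half row → Vertex row
  | .lineE i => .inl i
  | .lineW i => .inl i
  | .stemBot j _ => .inl j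
  | .stemTop j h => .inr (.inl ⟨j, h⟩)
  | .arcL a => open Classical in
      if h : IsDouble row a.left then .inr (.inl ⟨_, h⟩) else .inl a.left
  | .arcR a => open Classical in
      if h : IsDouble row a.right then .inr (.inl ⟨_, h⟩) else .inl a.right
  | .cross c .ne => .inr (.inr (c, true))
  | .cross c .nw => .inr (.inr (c, true))
  | .cross c .sw => .inr (.inr (c, false))
  | .cross c .se => .inr (.inr (c, false))
  | .rung c o => open Classical in
      .inr (.inr (c, decide (out (.cross c .ne) ↔ o = true)))

theorem vertex_upward (i : Fin N) : (upward (row := row) i).vertex = .inl i := by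
  rcases upward_cases (row := row) i with ⟨h, e⟩ | ⟨a, rfl, h, e⟩ | ⟨a, rfl, h, e⟩ | ⟨-, -, e⟩ <;>
    rw [e] <;> simp [Half.vertex, *]

theorem vertex_rungTop (c : Crossing row) : c.rungTop.vertex = .inr (.inr (c, true)) := by
  simp [Crossing.rungTop, Half.vertex]

theorem vertex_rungBot (c : Crossing row) : c.rungBot.vertex = .inr (.inr (c, false)) := by
  simp [Crossing.rungBot, Half.vertex]

variable (row) in
theorem finite_half : Finite (Half row) := by
  have : Finite (Edge row × Bool) := inferInstance
  refine Finite.of_surjective (fun p : Edge row × Bool =>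
    if p.2 then p.1.half else
      match p.1 with
      | .inl i => .lineW i
      | .inr (.inl j) => .stemTop j.1 j.2
      | .inr (.inr (.inl a)) => .arcR a
      | .inr (.inr (.inr (c, 0))) => .cross c .nw
      | .inr (.inr (.inr (c, 1))) => .cross c .sw
      | .inr (.inr (.inr (c, 2))) => .rung c false) fun d => ?_
  by_cases hd : d.East
  · obtain ⟨x, hx⟩ := Edge.half_surjective hd
    exact ⟨(x, true), by simp [hx]⟩
  · cases d with
    | lineW i => exact ⟨(.inl i, false), rfl⟩
    | stemTop j h => exact ⟨(.inr (.inl ⟨j, h⟩), false), rfl⟩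
    | arcR a => exact ⟨(.inr (.inr (.inl a)), false), rfl⟩
    | cross c q =>
      cases q with
      | nw => exact ⟨(.inr (.inr (.inr (c, 0))), false), rfl⟩
      | sw => exact ⟨(.inr (.inr (.inr (c, 1))), false), rfl⟩
      | _ => exact absurd trivial hd
    | rung c o =>
      obtain rfl : o = false := by simpa [Half.East] using hd
      exact ⟨(.inr (.inr (.inr (c, 2))), false), rfl⟩
    | _ => exact absurd trivial hd

instance : Finite (Half row) := finite_half row

/-- At most one web edge ends at a boundary point, and it starts with `upward i`. -/
theorem inl_vertex {d : Half row} {i : Fin N} (h : d.vertex = .inl i) :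
    d = .lineE i ∨ d = .lineW i ∨ d = upward i := by
  cases d with
  | lineE j => simp_all [Half.vertex]
  | lineW j => simp_all [Half.vertex]
  | stemBot j hj =>
    obtain rfl : j = i := by simpa [Half.vertex] using h
    exact Or.inr (Or.inr (upward_of_isDouble hj).symm)
  | arcL a =>
    by_cases hd : IsDouble row a.left
    · simp [Half.vertex, hd] at h
    · obtain rfl : a.left = i := by simpa [Half.vertex, hd] using h
      exact Or.inr (Or.inr (upward_left hd).symm)
  | arcR a =>
    by_cases hd : IsDouble row a.right
    · simp [Half.vertex, hd] at h
    · obtain rfl : a.right = i := by simpa [Half.vertex, hd] using h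
      exact Or.inr (Or.inr (upward_right hd).symm)
  | cross c q => cases q <;> simp [Half.vertex] at h
  | _ => simp [Half.vertex] at h

theorem vertex_rot (h3 : ∀ i, row i ≤ 2) (d : Half row) : (rot d).vertex = d.vertex := by
  cases d with
  | lineE i => exact vertex_upward i
  | lineW i => rfl
  | stemBot j h => rfl
  | stemTop j h =>
    obtain ⟨b, rfl⟩ := h.exists_left
    rw [rot_stemTop h rfl]
    simp [Half.vertex, h]
  | arcL b =>
    by_cases h : IsDouble row b.left
    · obtain ⟨a, ha⟩ := h.1
      rw [rot_arcL ha]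
      simp [Half.vertex, ha, h]
    · rw [rot_arcL_of_not h]; simp [Half.vertex, h]
  | arcR a =>
    by_cases h : IsDouble row a.right
    · rw [rot_arcR h]; simp [Half.vertex, h]
    · rw [rot_arcR_of_not h]; simp [Half.vertex, h]
  | cross c q =>
    cases q with
    | ne => rw [rot_ne h3]; rfl
    | nw => rw [rot_nw h3, vertex_rungTop]; rfl
    | sw => rw [rot_sw h3]; rfl
    | se => rw [rot_se h3, vertex_rungBot]; rfl
  | rung c o =>
    rcases rung_cases c o with h | h <;> rw [h]
    · rw [rot_rungTop, vertex_rungTop]; rfl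
    · rw [rot_rungBot, vertex_rungBot]; rfl

theorem rot_surjective (h3 : ∀ i, row i ≤ 2) : Function.Surjective (rot (row := row)) := by
  intro d
  cases d with
  | lineE i => exact ⟨.lineW i, rfl⟩
  | lineW i =>
    rcases upward_cases (row := row) i with ⟨h, e⟩ | ⟨a, rfl, h, e⟩ | ⟨a, rfl, h, e⟩ | ⟨-, -, e⟩
    · exact ⟨.stemBot i h, rfl⟩
    · exact ⟨.arcR a, rot_arcR_of_not h⟩
    · exact ⟨.arcL a, rot_arcL_of_not h⟩
    · exact ⟨.lineE i, e⟩
  | stemBot j h => exact ⟨.lineE j, upward_of_isDouble h⟩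
  | stemTop j h =>
    obtain ⟨a, rfl⟩ := h.1
    exact ⟨.arcR a, rot_arcR h⟩
  | arcL b =>
    by_cases h : IsDouble row b.left
    · exact ⟨.stemTop b.left h, rot_stemTop h rfl⟩
    · exact ⟨.lineE b.left, upward_left h⟩
  | arcR a =>
    by_cases h : IsDouble row a.right
    · obtain ⟨b, hb⟩ := h.exists_left
      exact ⟨.arcL b, rot_arcL hb.symm⟩
    · exact ⟨.lineE a.right, upward_right h⟩
  | cross c q =>
    cases q with
    | ne => exact ⟨_, rot_rungTop c⟩
    | nw => exact ⟨_, rot_ne h3 c⟩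
    | sw => exact ⟨_, rot_rungBot c⟩
    | se => exact ⟨_, rot_sw h3 c⟩
  | rung c o =>
    rcases rung_cases c o with h | h <;> rw [h]
    · exact ⟨_, rot_nw h3 c⟩
    · exact ⟨_, rot_se h3 c⟩

theorem rot_bijective (h3 : ∀ i, row i ≤ 2) : Function.Bijective (rot (row := row)) :=
  Finite.injective_iff_bijective.1 (Finite.injective_iff_surjective.2 (rot_surjective h3))

theorem opp_injective (h3 : ∀ i, row i ≤ 2) : Function.Injective (opp (row := row)) :=
  Function.LeftInverse.injective (opp_opp h3)

/-- A half-edge at a given vertex. -/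
def Vertex.half : Vertex row → Half row
  | .inl i => .lineE i
  | .inr (.inl j) => .stemTop j.1 j.2
  | .inr (.inr (c, true)) => .cross c .ne
  | .inr (.inr (c, false)) => .cross c .sw

theorem vertex_half (v : Vertex row) : v.half.vertex = v := by
  rcases v with i | j | ⟨c, _ | _⟩ <;> rfl

/-- With `vertex_rot` this identifies the orbits of `rot` with the fibres of `Half.vertex`. -/
theorem onOrbit_rot_half (h3 : ∀ i, row i ≤ 2) (d : Half row) : OnOrbit rot d.vertex.half d := by
  cases d with
  | lineE i => exact .refl _
  | lineW i =>
    rcases upward_cases (row := row) i with ⟨h, e⟩ | ⟨a, rfl, h, e⟩ | ⟨a, rfl, h, e⟩ | ⟨-, -, e⟩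
    · exact ⟨2, by change rot (upward i) = _; rw [e]; rfl⟩
    · exact ⟨2, by change rot (upward a.right) = _; rw [e]; exact rot_arcR_of_not h⟩
    · exact ⟨2, by change rot (upward a.left) = _; rw [e]; exact rot_arcL_of_not h⟩
    · exact ⟨1, e⟩
  | stemBot j h => exact ⟨1, upward_of_isDouble h⟩
  | stemTop j h => exact .refl _
  | arcL b =>
    by_cases h : IsDouble row b.left
    · simp only [Half.vertex, h, dite_true]
      exact ⟨1, rot_stemTop h rfl⟩
    · simp only [Half.vertex, h, dite_false]
      exact ⟨1, upward_left h⟩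
  | arcR a =>
    by_cases h : IsDouble row a.right
    · obtain ⟨b, hb⟩ := h.exists_left
      simp only [Half.vertex, h, dite_true]
      exact ⟨2, by change rot (rot (.stemTop _ h)) = _; rw [rot_stemTop h hb, rot_arcL hb.symm]⟩
    · simp only [Half.vertex, h, dite_false]
      exact ⟨1, upward_right h⟩
  | cross c q =>
    cases q with
    | ne => exact .refl _
    | nw => exact ⟨1, rot_ne h3 c⟩
    | sw => exact .refl _
    | se => exact ⟨1, rot_sw h3 c⟩
  | rung c o =>
    rcases rung_cases c o with h | h <;> rw [h]
    · rw [vertex_rungTop]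
      exact ⟨2, by change rot (rot _) = _; rw [Vertex.half, rot_ne h3, rot_nw h3]⟩
    · rw [vertex_rungBot]
      exact ⟨2, by change rot (rot _) = _; rw [Vertex.half, rot_sw h3, rot_se h3]⟩

theorem numOrbits_rot (h3 : ∀ i, row i ≤ 2) : numOrbits (rot (row := row)) =
    N + Nat.card {j : Fin N // IsDouble row j} + 2 * Nat.card (Crossing row) := by
  rw [numOrbits_eq_card (rot_bijective h3).1 Vertex.half
    (fun d => ⟨_, onOrbit_rot_half h3 d⟩) (fun x y h => ?_)]
  · rw [Nat.card_sum, Nat.card_sum, Nat.card_prod]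
    simp only [Nat.card_eq_fintype_card, Fintype.card_fin, Fintype.card_bool]
    ring
  · have := h.invariant (vertex_rot h3)
    rw [vertex_half, vertex_half] at this
    exact this.symm

/-- Every edge has exactly one east half. An arc contributes one at its left end, a crossing two on
its arcs and one on its rung. -/
theorem numOrbits_opp (h3 : ∀ i, row i ≤ 2) : numOrbits (opp (row := row)) =
    N + Nat.card {j : Fin N // IsDouble row j} + Nat.card (Arc row) +
      3 * Nat.card (Crossing row) := by
  rw [numOrbits_eq_card (opp_injective h3) Edge.half (fun d => ?_) (fun x y h => ?_)]
  · rw [Nat.card_sum, Nat.card_sum, Nat.card_sum, Nat.card_prod]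
    simp only [Nat.card_eq_fintype_card, Fintype.card_fin]
    ring
  · by_cases hd : d.East
    · obtain ⟨x, hx⟩ := Edge.half_surjective hd
      exact ⟨x, hx ▸ .refl _⟩
    · obtain ⟨x, hx⟩ := Edge.half_surjective ((east_opp d).2 hd)
      exact ⟨x, 1, by rw [hx]; exact opp_opp h3 d⟩
  · obtain ⟨n, hn⟩ := h
    have : ∀ n, opp^[n] x.half = x.half ∨ opp^[n] x.half = opp x.half := by
      intro n
      induction n with
      | zero => exact Or.inl rfl
      | succ n ih =>
        rw [Function.iterate_succ_apply']
        rcases ih with h | h <;> rw [h]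
        · exact Or.inr rfl
        · exact Or.inl (opp_opp h3 _)
    rcases this n with h | h
    · exact Edge.half_injective (h.symm.trans hn)
    · have h1 := (east_opp x.half).1
      rw [← h, hn] at h1
      exact absurd x.half_east (h1 y.half_east)

end Vertices

/-! ### Local web axioms and connectedness -/

section Web

variable {N : ℕ}

theorem finRotate_val (i : Fin N) :
    ((finRotate N i : Fin N) : ℕ) = if (i : ℕ) + 1 < N then (i : ℕ) + 1 else 0 := by
  cases N with
  | zero => exact i.elim0
  | succ n =>
    split_ifs with h
    · exact coe_finRotate_of_ne_last (by rintro rfl; simp at h)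
    · have : i = Fin.last n := Fin.ext (by have := i.2; simp; omega)
      rw [this, finRotate_last]; rfl

variable {row : Fin N → ℕ}

variable (row) in
/-- The resolved m-diagram of a placement of numbers in rows. -/
noncomputable def graph : DiskGraph where
  Half := Half row
  rot := rot
  opp := opp
  line := {d | ∃ i, d = .lineE i ∨ d = .lineW i}
  out := out

/-- One step along the boundary of a face of the resolved m-diagram. -/
noncomputable def step (d : Half row) : Half row := rot (opp d)

theorem step_lineE (i : Fin N) : step (row := row) (.lineE i) = .lineE (finRotate N i) := rfl

theorem step_injective (h3 : ∀ i, row i ≤ 2) : Function.Injective (step (row := row)) :=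
  (rot_bijective h3).1.comp (opp_injective h3)

theorem step_opp (h3 : ∀ i, row i ≤ 2)
    (d : Half row) : step (opp d) = rot d := by rw [step, opp_opp h3]

theorem onOrbit_step_lineE (h3 : ∀ i, row i ≤ 2) (i j : Fin N) :
    OnOrbit (step (row := row)) (.lineE i) (.lineE j) := by
  have hN : 0 < N := i.pos
  have key : ∀ k (hk : k < N), OnOrbit (step (row := row)) (.lineE ⟨0, hN⟩) (.lineE ⟨k, hk⟩) := by
    intro k
    induction k with
    | zero => intro _; exact .refl _
    | succ k ih =>
      intro hk
      refine (ih (by omega)).trans ⟨1, ?_⟩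
      rw [Function.iterate_one, step_lineE]
      congr 1
      exact Fin.ext (by rw [finRotate_val]; simp [hk])
  exact ((key i i.2).symm (step_injective h3)).trans (key j j.2)

theorem lineE_of_onOrbit_step {i : Fin N} {d : Half row} (h : OnOrbit step (.lineE i) d) :
    ∃ j, d = .lineE j := by
  obtain ⟨n, rfl⟩ := h
  induction n with
  | zero => exact ⟨i, rfl⟩
  | succ n ih =>
    obtain ⟨j, hj⟩ := ih
    exact ⟨_, by rw [Function.iterate_succ_apply', hj, step_lineE]⟩

theorem trivalent (h3 : ∀ i, row i ≤ 2)
    (d : Half row) (hd : ∀ e, OnOrbit rot d e → ¬ ∃ i, e = .lineE i ∨ e = .lineW i) :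
    {e | OnOrbit rot d e}.ncard = 3 := by
  have key : rot (rot (rot d)) = d ∧ rot d ≠ d := by
    cases d with
    | lineE i => exact absurd ⟨i, Or.inl rfl⟩ (hd _ (.refl _))
    | lineW i => exact absurd ⟨i, Or.inr rfl⟩ (hd _ (.refl _))
    | stemBot j h => exact absurd ⟨j, Or.inr rfl⟩ (hd _ (.step _))
    | stemTop j h =>
      obtain ⟨a, rfl⟩ := h.1
      obtain ⟨b, hb⟩ := h.exists_left
      rw [rot_stemTop h hb, rot_arcL hb.symm, rot_arcR h]
      simp
    | arcL b =>
      by_cases h : IsDouble row b.left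
      · obtain ⟨a, ha⟩ := h.1
        rw [rot_arcL ha, rot_arcR (isDouble_right ha), rot_stemTop _ ha.symm]
        simp
      · exact absurd ⟨_, Or.inr (rot_arcL_of_not h)⟩ (hd _ (.step _))
    | arcR a =>
      by_cases h : IsDouble row a.right
      · obtain ⟨b, hb⟩ := h.exists_left
        rw [rot_arcR h, rot_stemTop h hb, rot_arcL hb.symm]
        simp
      · exact absurd ⟨_, Or.inr (rot_arcR_of_not h)⟩ (hd _ (.step _))
    | cross c q =>
      cases q with
      | ne => rw [rot_ne h3, rot_nw h3, rot_rungTop]; simp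
      | nw => rw [rot_nw h3, rot_rungTop, rot_ne h3]; simp [Crossing.rungTop]
      | sw => rw [rot_sw h3, rot_se h3, rot_rungBot]; simp
      | se => rw [rot_se h3, rot_rungBot, rot_sw h3]; simp [Crossing.rungBot]
    | rung c o =>
      rcases rung_cases c o with h | h <;> rw [h]
      · rw [rot_rungTop, rot_ne h3, rot_nw h3]; simp [Crossing.rungTop]
      · rw [rot_rungBot, rot_sw h3, rot_se h3]; simp [Crossing.rungBot]
  exact ncard_orbit_eq_three key.1 key.2

theorem boundary_degree (h3 : ∀ i, row i ≤ 2)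
    (d : Half row) (hd : ∃ i, d = .lineE i ∨ d = .lineW i) :
    {e | OnOrbit rot d e ∧ ¬ ∃ i, e = .lineE i ∨ e = .lineW i}.ncard ≤ 1 := by
  obtain ⟨i, hi⟩ := hd
  have hv : d.vertex = .inl i := by rcases hi with rfl | rfl <;> rfl
  refine (Set.ncard_le_ncard (t := {upward i}) ?_).trans (Set.ncard_singleton _).le
  rintro e ⟨he, hn⟩
  rcases inl_vertex ((he.invariant (vertex_rot h3)).trans hv) with h | h | h
  · exact absurd ⟨i, Or.inl h⟩ hn
  · exact absurd ⟨i, Or.inr h⟩ hn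
  · exact h

theorem source_or_sink (h3 : ∀ i, row i ≤ 2)
    {d e : Half row} (hd : ¬ ∃ i, d = .lineE i ∨ d = .lineW i)
    (he : ¬ ∃ i, e = .lineE i ∨ e = .lineW i) (h : OnOrbit rot d e) : out d ↔ out e := by
  have hv := h.invariant (vertex_rot h3)
  -- The vertex of a `Y` is a sink: the stem comes from the boundary, the arc ending there is first
  -- and the arc starting there is second.
  have hY : ∀ (d : Half row) j, d.vertex = .inr (.inl j) → ¬ out d := by
    intro d j h
    cases d with
    | stemTop j h => exact id
    | arcL b =>
      by_cases hb : IsDouble row b.left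
      · exact not_isFirst_of_isDouble hb
      · simp [Half.vertex, hb] at h
    | arcR a =>
      by_cases ha : IsDouble row a.right
      · simpa [out] using isFirst_of_isDouble h3 ha
      · simp [Half.vertex, ha] at h
    | cross c q => cases q <;> simp [Half.vertex] at h
    | _ => simp [Half.vertex] at h
  have hX : ∀ (d : Half row) c t, d.vertex = .inr (.inr (c, t)) →
      (out d ↔ (out (.cross c .ne) ↔ t = true)) := by
    intro d c t h
    cases d with
    | arcL b => by_cases hb : IsDouble row b.left <;> simp [Half.vertex, hb] at h
    | arcR b => by_cases hb : IsDouble row b.right <;> simp [Half.vertex, hb] at h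
    | cross c q =>
      cases q <;> simp only [Half.vertex, Sum.inr.injEq, Prod.mk.injEq] at h <;>
        obtain ⟨rfl, rfl⟩ := h
      · simp
      · simp [out_nw h3]
      · simp [out_sw h3]
      · simp [out_se h3]
    | rung c o =>
      simp only [Half.vertex, Sum.inr.injEq, Prod.mk.injEq] at h
      obtain ⟨rfl, rfl⟩ := h
      simp only [decide_eq_true_eq]
      change o = true ↔ _
      tauto
    | _ => simp [Half.vertex] at h
  rcases hdv : d.vertex with i | j | ⟨c, t⟩
  · rw [hdv] at hv
    rcases inl_vertex hdv with h | h | h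
    · exact absurd ⟨i, Or.inl h⟩ hd
    · exact absurd ⟨i, Or.inr h⟩ hd
    rcases inl_vertex hv with h' | h' | h'
    · exact absurd ⟨i, Or.inl h'⟩ he
    · exact absurd ⟨i, Or.inr h'⟩ he
    rw [h, h']
  · exact iff_of_false (hY d j hdv) (hY e j (hv.trans hdv))
  · rw [hX d c t hdv, hX e c t (hv.trans hdv)]

/-- The resolved m-diagram is connected. -/
theorem numComponents_graph (h3 : ∀ i, row i ≤ 2) (hN : 0 < N) : (graph row).numComponents = 1 := by
  let r : Half row → Half row → Prop := fun d e => e = rot d ∨ e = opp d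
  let z : Half row := .lineE ⟨0, hN⟩
  have hrot : ∀ d e : Half row, OnOrbit rot d e → Quot.mk r d = Quot.mk r e := by
    rintro d e h
    refine (h.invariant (g := Quot.mk r) fun d => ?_).symm
    exact (Quot.sound (r := r) (Or.inl rfl)).symm
  have hopp : ∀ d : Half row, Quot.mk r d = Quot.mk r (opp d) :=
    fun d => Quot.sound (r := r) (Or.inr rfl)
  have hstep : ∀ d e : Half row, OnOrbit step d e → Quot.mk r d = Quot.mk r e := by
    rintro d e h
    refine (h.invariant (g := Quot.mk r) fun d => ?_).symm
    exact ((hopp d).trans (hrot _ _ (.step _))).symm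
  have hline : ∀ i, Quot.mk r (.lineE i) = Quot.mk r z :=
    fun i => hstep _ _ (onOrbit_step_lineE h3 _ _)
  have hY : ∀ j (h : IsDouble row j), Quot.mk r (.stemTop j h) = Quot.mk r z := fun j h =>
    (hopp _).trans ((hrot _ _ (onOrbit_rot_half h3 (.stemBot j h))).symm.trans (hline j))
  -- Each of the two vertices of a crossing carries a westward half-edge, leading to a boundary
  -- point, a double point or a crossing further left; induction on `x` applies.
  have hX : ∀ (c : Crossing row) (t : Bool),
      Quot.mk r (Vertex.half (.inr (.inr (c, t)))) = Quot.mk r z := by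
    have wf : WellFounded fun c c' : Crossing row => c.x < c'.x :=
      (Finite.wellFounded_of_trans_of_irrefl (r := fun c c' : Crossing row => c.x < c'.x))
    intro c
    induction c using wf.induction with
    | _ c ih =>
    have key : ∀ d : Half row, d.pos = c.x → (∃ a, d.arc? = some a) → ¬ d.East →
        Quot.mk r d = Quot.mk r z := by
      rintro d hp ⟨a, ha⟩ hE
      obtain ⟨e1, e2, e3, -⟩ := opp_west_spec ha hE
      rw [hp] at e3
      rw [hopp, ← hrot _ _ (onOrbit_rot_half h3 (opp d))]
      generalize opp d = e at *
      cases e with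
      | arcL b =>
        by_cases hb : IsDouble row b.left
        · simp only [Half.vertex, hb, dite_true]
          exact hY _ hb
        · simp only [Half.vertex, hb, dite_false]
          exact hline _
      | cross c' q =>
        cases q with
        | ne => exact ih c' e3 true
        | se => exact ih c' e3 false
        | _ => exact absurd e2 id
      | arcR b => exact absurd e2 id
      | _ => simp [Half.arc?] at e1
    intro t
    cases t with
    | true =>
      exact (hrot (.cross c .ne) (.cross c .nw) ⟨1, rot_ne h3 c⟩).trans
        (key (.cross c .nw) rfl ⟨_, rfl⟩ id)
    | false => exact key (.cross c .sw) rfl ⟨_, rfl⟩ id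
  have hall : ∀ d : Half row, Quot.mk r d = Quot.mk r z := by
    intro d
    rw [← hrot _ _ (onOrbit_rot_half h3 d)]
    rcases d.vertex with i | j | ⟨c, t⟩
    · exact hline i
    · exact hY _ _
    · exact hX c t
  have : Unique (Quot r) :=
    { default := Quot.mk r z
      uniq := fun x => Quot.ind (β := fun x => x = Quot.mk r z) hall x }
  exact Nat.card_unique (α := Quot r)

end Web

/-! ### The arcs above a face -/

section Under

variable {N : ℕ} {row : Fin N → ℕ}

/-- The horizontal coordinate of a point inside the edge of a half-edge. -/
noncomputable def Half.mid (d : Half row) : ℚ := (d.pos + (opp d).pos) / 2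

/-- For a half-edge on the arc `a`: the face on its right lies under the arc `e`. -/
def UnderArc (d : Half row) (a e : Arc row) : Prop :=
  (e = a ∧ d.East) ∨ (e ≠ a ∧ a.height d.mid < e.height d.mid)

/-- The face on the right of a half-edge lies under the arc `e`. -/
def Under : Half row → Arc row → Prop
  | .lineE _, _ => False
  | .lineW i, e => e.left < i ∧ i ≤ e.right
  | .stemBot j _, e => e.left ≤ j ∧ j < e.right
  | .stemTop j _, e => e.left < j ∧ j ≤ e.right
  | .arcL a, e => UnderArc (.arcL a) a e
  | .arcR a, e => UnderArc (.arcR a) a e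
  | .cross c q, e => UnderArc (.cross c q) (c.arc q) e
  | .rung c o, e => c.a.height c.x < e.height c.x ∨
      (e = c.a ∧ (out (.cross c .ne) ↔ o = true)) ∨ (e = c.b ∧ ¬ (out (.cross c .ne) ↔ o = true))

theorem under_of_arc? {d : Half row} {a e : Arc row} (h : d.arc? = some a) :
    Under d e ↔ UnderArc d a e := by
  cases d <;> simp_all [Half.arc?, Under]

theorem under_rungTop (c : Crossing row) (e : Arc row) :
    Under c.rungTop e ↔ c.a.height c.x < e.height c.x ∨ e = c.a := by
  simp [Crossing.rungTop, Under]

theorem under_rungBot (c : Crossing row) (e : Arc row) :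
    Under c.rungBot e ↔ c.a.height c.x < e.height c.x ∨ e = c.b := by
  simp [Crossing.rungBot, Under]

/-- An intermediate value argument for an affine function: a change of sign would produce an
explicit rational zero, so no continuity is needed. -/
theorem height_mid_lt_of_pos_lt {a e : Arc row} {p m : ℚ}
    (hz : ∀ t : ℚ, 0 < t → t ≤ 1 → e.height (p + t * (m - p)) ≠ a.height (p + t * (m - p)))
    (h : a.height p < e.height p) : a.height m < e.height m := by
  by_contra hc
  have hd : 0 < (e.height p - a.height p) - (e.height m - a.height m) := by linarith
  refine hz ((e.height p - a.height p) / ((e.height p - a.height p) - (e.height m - a.height m)))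
    (div_pos (by linarith) hd) ((div_le_one hd).2 (by linarith)) ?_
  generalize ht : (e.height p - a.height p) / ((e.height p - a.height p) -
    (e.height m - a.height m)) = t
  rw [div_eq_iff hd.ne'] at ht
  unfold Arc.height at ht ⊢
  linarith

theorem mid_east {d : Half row} {a : Arc row} (h : d.arc? = some a) (hd : d.East) :
    d.pos < d.mid ∧ d.mid < (opp d).pos := by
  have := (opp_east_spec h hd).2.2.1
  unfold Half.mid
  constructor <;> linarith

theorem mid_west {d : Half row} {a : Arc row} (h : d.arc? = some a) (hd : ¬ d.East) :
    (opp d).pos < d.mid ∧ d.mid < d.pos := by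
  have := (opp_west_spec h hd).2.2.1
  unfold Half.mid
  constructor <;> linarith

theorem left_lt_mid {d : Half row} {a : Arc row} (h : d.arc? = some a) :
    ((a.left : ℕ) : ℚ) < d.mid := by
  by_cases hd : d.East
  · exact (Half.left_le_pos h).trans_lt (mid_east h hd).1
  · exact (Half.left_le_pos (arc?_opp h)).trans_lt (mid_west h hd).1

theorem mid_lt_right {d : Half row} {a : Arc row} (h : d.arc? = some a) :
    d.mid < (a.right : ℕ) := by
  by_cases hd : d.East
  · exact (mid_east h hd).2.trans_le (Half.pos_le_right (arc?_opp h))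
  · exact (mid_west h hd).2.trans_le (Half.pos_le_right h)

/-- No arc meets an edge of another arc inside. -/
theorem height_ne_of_inside {d : Half row} {a e : Arc row} (h : d.arc? = some a) (hne : e ≠ a)
    {t : ℚ} (h0 : 0 < t) (h1 : t ≤ 1) :
    e.height (d.pos + t * (d.mid - d.pos)) ≠ a.height (d.pos + t * (d.mid - d.pos)) := by
  intro hz
  -- Equal heights at `x` give a crossing on `a` strictly between the two ends of the edge. The
  -- value `t = 0` is excluded because `e` may cross `a` at the base point itself.
  generalize hx : d.pos + t * (d.mid - d.pos) = x at hz
  by_cases hd : d.East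
  · obtain ⟨m1, m2⟩ := mid_east h hd
    have k1 : 0 < t * (d.mid - d.pos) := mul_pos h0 (by linarith)
    have k2 : t * (d.mid - d.pos) ≤ 1 * (d.mid - d.pos) :=
      mul_le_mul_of_nonneg_right h1 (by linarith)
    have l1 := left_lt_mid h
    have l2 := mid_lt_right h
    have l3 := Half.left_le_pos h
    obtain ⟨c, ca, -, cx⟩ := exists_crossing hne (x := x) (by linarith) (by linarith) hz
    have := (opp_east_spec h hd).2.2.2 c ca (by linarith)
    linarith
  · obtain ⟨m1, m2⟩ := mid_west h hd
    have k1 : 0 < t * (d.pos - d.mid) := mul_pos h0 (by linarith)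
    have k2 : t * (d.pos - d.mid) ≤ 1 * (d.pos - d.mid) :=
      mul_le_mul_of_nonneg_right h1 (by linarith)
    have l1 := left_lt_mid h
    have l2 := mid_lt_right h
    have l3 := Half.pos_le_right h
    obtain ⟨c, ca, -, cx⟩ := exists_crossing hne (x := x) (by linarith) (by linarith) hz
    have := (opp_west_spec h hd).2.2.2 c ca (by linarith)
    linarith

theorem height_mid_lt {d : Half row} {a e : Arc row} (h : d.arc? = some a) (hne : e ≠ a)
    (hp : a.height d.pos < e.height d.pos) : a.height d.mid < e.height d.mid :=
  height_mid_lt_of_pos_lt (fun _ h0 h1 => height_ne_of_inside h hne h0 h1) hp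

theorem height_mid_gt {d : Half row} {a e : Arc row} (h : d.arc? = some a) (hne : e ≠ a)
    (hp : e.height d.pos < a.height d.pos) : e.height d.mid < a.height d.mid :=
  height_mid_lt_of_pos_lt (fun _ h0 h1 => (height_ne_of_inside h hne h0 h1).symm) hp

/-- At its left end `a` is on the boundary line, so `e` is higher there exactly when the point is
strictly inside `e`; with no crossing on the edge, the strict comparison persists to the midpoint.
-/
theorem height_mid_arcL {a e : Arc row} (hne : e ≠ a) :
    a.height (Half.arcL a).mid < e.height (Half.arcL a).mid ↔
      e.left < a.left ∧ a.left < e.right := by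
  have h : (Half.arcL a).arc? = some a := rfl
  have hm := mid_east h trivial
  have hp : a.height (Half.arcL a).pos = (Half.arcL a).pos ^ 2 := a.height_left
  constructor
  · intro hlt
    have h1 : e.left ≠ a.left := fun h' => hne (Arc.ext_left h')
    by_contra hc
    rcases lt_or_gt_of_ne h1 with h1 | h1
    · rcases (not_lt.1 fun h2 => hc ⟨h1, h2⟩).lt_or_eq with h2 | h2
      -- At a double point the heights agree at the end, so the comparison is made at the midpoint,
      -- already beyond `e`.
      · have h2' : ((e.right : ℕ) : ℚ) < (Half.arcL a).pos := Nat.cast_lt.2 h2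
        linarith [height_mid_gt h hne (hp ▸ Arc.height_lt_sq_of_gt h2')]
      · have h2' : ((e.right : ℕ) : ℚ) < (Half.arcL a).mid := by rw [h2]; exact hm.1
        linarith [Arc.height_lt_sq_of_gt h2', Arc.sq_lt_height (left_lt_mid h) (mid_lt_right h)]
    · have h2' : (Half.arcL a).pos < ((e.left : ℕ) : ℚ) := Nat.cast_lt.2 h1
      linarith [height_mid_gt h hne (hp ▸ Arc.height_lt_sq_of_lt h2')]
  · rintro ⟨h1, h2⟩
    refine height_mid_lt h hne (hp ▸ Arc.sq_lt_height ?_ ?_)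
    · exact Nat.cast_lt.2 h1
    · exact Nat.cast_lt.2 h2

theorem height_mid_arcR {a e : Arc row} (hne : e ≠ a) :
    a.height (Half.arcR a).mid < e.height (Half.arcR a).mid ↔
      e.left < a.right ∧ a.right < e.right := by
  have h : (Half.arcR a).arc? = some a := rfl
  have hm := mid_west h id
  have hp : a.height (Half.arcR a).pos = (Half.arcR a).pos ^ 2 := a.height_right
  constructor
  · intro hlt
    have h1 : e.right ≠ a.right := fun h' => hne (Arc.ext_right h')
    by_contra hc
    rcases lt_or_gt_of_ne h1 with h1 | h1
    · have h2' : ((e.right : ℕ) : ℚ) < (Half.arcR a).pos := Nat.cast_lt.2 h1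
      linarith [height_mid_gt h hne (hp ▸ Arc.height_lt_sq_of_gt h2')]
    · rcases (not_lt.1 fun h2 => hc ⟨h2, h1⟩).lt_or_eq with h2 | h2
      · have h2' : (Half.arcR a).pos < ((e.left : ℕ) : ℚ) := Nat.cast_lt.2 h2
        linarith [height_mid_gt h hne (hp ▸ Arc.height_lt_sq_of_lt h2')]
      · have h2' : (Half.arcR a).mid < ((e.left : ℕ) : ℚ) := by rw [← h2]; exact hm.2
        linarith [Arc.height_lt_sq_of_lt h2', Arc.sq_lt_height (left_lt_mid h) (mid_lt_right h)]
  · rintro ⟨h1, h2⟩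
    refine height_mid_lt h hne (hp ▸ Arc.sq_lt_height ?_ ?_)
    · exact Nat.cast_lt.2 h1
    · exact Nat.cast_lt.2 h2

theorem mid_opp (h3 : ∀ i, row i ≤ 2) (d : Half row) : (opp d).mid = d.mid := by
  unfold Half.mid
  rw [opp_opp h3, add_comm]

/-- The face on the left of a half-edge on an arc. -/
theorem under_opp (h3 : ∀ i, row i ≤ 2) {d : Half row} {a e : Arc row} (h : d.arc? = some a) :
    Under (opp d) e ↔ (e = a ∧ ¬ d.East) ∨ (e ≠ a ∧ a.height d.mid < e.height d.mid) := by
  rw [under_of_arc? (arc?_opp h), UnderArc, east_opp, mid_opp h3]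

theorem under_arcL (a e : Arc row) :
    Under (.arcL a) e ↔ e.left ≤ a.left ∧ a.left < e.right := by
  rw [under_of_arc? rfl, UnderArc]
  by_cases he : e = a
  · subst he
    simp [Half.East, e.left_lt_right]
  · have h1 : e.left ≠ a.left := fun h' => he (Arc.ext_left h')
    simp [he, height_mid_arcL he, h1.le_iff_lt]

theorem under_opp_arcL (h3 : ∀ i, row i ≤ 2) (a e : Arc row) :
    Under (opp (.arcL a)) e ↔ e.left < a.left ∧ a.left < e.right := by
  rw [under_opp h3 rfl]
  by_cases he : e = a
  · subst he
    simp [Half.East]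
  · simp [he, height_mid_arcL he]

theorem under_arcR (a e : Arc row) :
    Under (.arcR a) e ↔ e.left < a.right ∧ a.right < e.right := by
  rw [under_of_arc? rfl, UnderArc]
  by_cases he : e = a
  · subst he
    simp [Half.East]
  · simp [he, height_mid_arcR he]

theorem under_opp_arcR (h3 : ∀ i, row i ≤ 2) (a e : Arc row) :
    Under (opp (.arcR a)) e ↔ e.left < a.right ∧ a.right ≤ e.right := by
  rw [under_opp h3 rfl]
  by_cases he : e = a
  · subst he
    simp [Half.East, e.left_lt_right]
  · have h1 : a.right ≠ e.right := fun h' => he (Arc.ext_right h'.symm)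
    simp [he, height_mid_arcR he, h1.le_iff_lt]

/-- An arc that does not run through a crossing lies on the same side of it as of the edges at the
crossing. -/
theorem height_mid_cross (h3 : ∀ i, row i ≤ 2)
    {c : Crossing row} {q : Quadrant} {e : Arc row} (ha : e ≠ c.a)
    (hb : e ≠ c.b) : (c.arc q).height (Half.cross c q).mid < e.height (Half.cross c q).mid ↔
      c.a.height c.x < e.height c.x := by
  have h : (Half.cross c q).arc? = some (c.arc q) := rfl
  have hon := Half.arc?_cross_on h
  have hne : e ≠ c.arc q := by cases q <;> assumption
  have hp : (c.arc q).height (Half.cross c q).pos = c.a.height c.x := hon.height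
  have hz : e.height c.x ≠ c.a.height c.x := fun hz => by
    obtain ⟨c', h1, h2, h3'⟩ := exists_crossing ha c.left_a_lt_x c.x_lt hz
    obtain rfl := h1.eq_of_x_eq h3 (Or.inl rfl : c.On c.a) h3'
    rcases h2 with h2 | h2
    · exact ha h2.symm
    · exact hb h2.symm
  constructor
  · intro hlt
    by_contra hc
    have := height_mid_gt h hne (by rw [hp]; exact lt_of_le_of_ne (not_lt.1 hc) hz)
    linarith
  · intro hlt
    exact height_mid_lt h hne (by rw [hp]; exact hlt)

/-- The eight sides of the four half-edges lie in four sectors. All sectors are under the arcs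
passing strictly above the point; in addition the west sector is under `c.a`, the east sector under
`c.b`, the south sector under both. -/
theorem under_cross (h3 : ∀ i, row i ≤ 2) (c : Crossing row) (e : Arc row) :
    (Under (.cross c .ne) e ↔ c.a.height c.x < e.height c.x ∨ e = c.b) ∧
    (Under (opp (.cross c .ne)) e ↔ c.a.height c.x < e.height c.x) ∧
    (Under (.cross c .nw) e ↔ c.a.height c.x < e.height c.x) ∧
    (Under (opp (.cross c .nw)) e ↔ c.a.height c.x < e.height c.x ∨ e = c.a) ∧
    (Under (.cross c .sw) e ↔ c.a.height c.x < e.height c.x ∨ e = c.a) ∧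
    (Under (opp (.cross c .sw)) e ↔ c.a.height c.x < e.height c.x ∨ e = c.a ∨ e = c.b) ∧
    (Under (.cross c .se) e ↔ c.a.height c.x < e.height c.x ∨ e = c.a ∨ e = c.b) ∧
    (Under (opp (.cross c .se)) e ↔ c.a.height c.x < e.height c.x ∨ e = c.b) := by
  rw [under_opp h3 (d := .cross c .ne) rfl, under_opp h3 (d := .cross c .nw) rfl,
    under_opp h3 (d := .cross c .sw) rfl, under_opp h3 (d := .cross c .se) rfl]
  simp only [Under, UnderArc, Half.East, Quadrant.IsEast]
  by_cases ha : e = c.a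
  · subst ha
    have h1 := c.height_lt_of_gt (mid_east (d := .cross c .ne) rfl trivial).1
    have h2 := c.height_lt_of_lt (mid_west (d := .cross c .sw) rfl id).2
    simp [Crossing.arc, c.a_ne_b, h1.le, h2]
  by_cases hb : e = c.b
  · subst hb
    have h1 := c.height_lt_of_gt (mid_east (d := .cross c .se) rfl trivial).1
    have h2 := c.height_lt_of_lt (mid_west (d := .cross c .nw) rfl id).2
    simp [Crossing.arc, c.a_ne_b.symm, h1, h2.le, c.height_eq]
  have hne : ∀ q, e ≠ c.arc q := by rintro (_ | _) <;> assumption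
  simp [height_mid_cross h3 ha hb, hne, ha, hb]

/-- The arcs above a face do not depend on the half-edge on its boundary. -/
theorem under_step (h3 : ∀ i, row i ≤ 2) {d : Half row} (hd : ¬ ∃ i, d = .lineE i) (e : Arc row) :
    Under (step d) e ↔ Under d e := by
  -- A step from `opp v` is a rotation from `v`: the claim compares the face on the left of `v` with
  -- the face on the right of the next half-edge at the same vertex.
  obtain ⟨v, rfl⟩ : ∃ v, opp v = d := ⟨opp d, opp_opp h3 d⟩
  rw [step_opp h3]
  have hlt := e.left_lt_right
  cases v with
  | lineW i => exact absurd ⟨_, rfl⟩ hd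
  | lineE i =>
    have h1 : Under (opp (.lineE i)) e ↔ e.left ≤ i ∧ i < e.right := by
      change e.left < finRotate N i ∧ finRotate N i ≤ e.right ↔ _
      -- At the last point `finRotate` wraps around to the first, and both sides are false.
      have := finRotate_val i
      simp only [Fin.lt_def, Fin.le_def, this] at hlt ⊢
      have := i.2
      have := e.right.2
      split_ifs <;> omega
    rw [h1]
    change Under (upward i) e ↔ _
    rcases upward_cases (row := row) i with ⟨h, q⟩ | ⟨a, rfl, h, q⟩ | ⟨a, rfl, h, q⟩ | ⟨h1, h2, q⟩
    · rw [q]; rfl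
    · rw [q, under_arcR]
      have h2 : e.left ≠ a.right := fun h' => h (isDouble_right h'.symm)
      rw [h2.le_iff_lt]
    · rw [q, under_arcL]
    · rw [q]
      have h1 : e.right ≠ i := fun h => h1 ⟨e, h⟩
      have h2 : e.left ≠ i := fun h => h2 ⟨e, h⟩
      rw [h2.le_iff_lt, ← h1.symm.le_iff_lt]
      rfl
  | stemBot j h => rfl
  | stemTop j h =>
    obtain ⟨b, rfl⟩ := h.exists_left
    rw [rot_stemTop h rfl, under_arcL]
    rfl
  | arcL b =>
    rw [under_opp_arcL h3]
    by_cases h : IsDouble row b.left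
    · obtain ⟨a, ha⟩ := h.1
      rw [rot_arcL ha, under_arcR, ha]
    · rw [rot_arcL_of_not h]
      have h1 : b.left ≠ e.right := fun h' => h (isDouble_of_eq h'.symm)
      rw [← h1.le_iff_lt]
      rfl
  | arcR a =>
    rw [under_opp_arcR h3]
    by_cases h : IsDouble row a.right
    · rw [rot_arcR h]; rfl
    · rw [rot_arcR_of_not h]; rfl
  | cross c q =>
    obtain ⟨-, n2, n3, n4, -, n6, n7, n8⟩ := under_cross h3 c e
    cases q with
    | ne => rw [rot_ne h3, n2, n3]
    | nw => rw [rot_nw h3, n4, under_rungTop]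
    | sw => rw [rot_sw h3, n6, n7]
    | se => rw [rot_se h3, n8, under_rungBot]
  | rung c o =>
    rcases rung_cases c o with h | h <;> rw [h]
    · rw [rot_rungTop, opp_rungTop, under_rungBot, (under_cross h3 c e).1]
    · rw [rot_rungBot, opp_rungBot, under_rungTop, (under_cross h3 c e).2.2.2.2.1]

theorem under_of_onOrbit_step (h3 : ∀ i, row i ≤ 2) {d d' : Half row} (hd : ¬ ∃ i, d = .lineE i)
    (h : OnOrbit step d d') : (¬ ∃ i, d' = .lineE i) ∧ ∀ e, Under d' e ↔ Under d e := by
  have h1 : ∀ d', OnOrbit step d d' → ¬ ∃ i, d' = .lineE i := by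
    rintro d' h ⟨i, rfl⟩
    exact hd (lineE_of_onOrbit_step (h.symm (step_injective h3)))
  refine ⟨h1 _ h, fun e => ?_⟩
  obtain ⟨n, rfl⟩ := h
  induction n with
  | zero => rfl
  | succ n ih => rw [Function.iterate_succ_apply', under_step h3 (h1 _ ⟨n, rfl⟩), ih]

end Under

/-! ### Counting faces, and planarity -/

section Faces

variable {N : ℕ} {row : Fin N → ℕ}

/-- The faces: the outside (`true`) and the inside face at the last point of the boundary line
(`false`), the faces whose rightmost point is the right end of an arc, and those whose rightmost
point is a crossing. -/
abbrev Face (row : Fin N → ℕ) : Type := Bool ⊕ Arc row ⊕ Crossing row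

/-- A half-edge on the boundary of a face. -/
noncomputable def Face.half (hN : 0 < N) : Face row → Half row
  | .inl true => .lineE ⟨0, hN⟩
  | .inl false => .lineW ⟨0, hN⟩
  | .inr (.inl a) => .lineW a.right
  | .inr (.inr c) => c.rungTop

theorem step_lineW_finRotate (i : Fin N) :
    step (row := row) (.lineW (finRotate N i)) = upward i := by
  change upward ((finRotate N).symm (finRotate N i)) = _
  rw [Equiv.symm_apply_apply]

/-- A crossing over which a face ends is not to the left of any other point of the face. -/
theorem x_le_x_of_under {c c' : Crossing row}
    (h : ∀ e, Under c.rungTop e ↔ Under c'.rungTop e) :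
    c'.a.height c'.x ≤ c.a.height c'.x ∧ c.b.height c'.x ≤ c'.a.height c'.x ∧ c'.x ≤ c.x := by
  have h1 : c'.a.height c'.x ≤ c.a.height c'.x := by
    have := (under_rungTop c' c.a).1 ((h c.a).1 ((under_rungTop c c.a).2 (Or.inr rfl)))
    rcases this with h | h
    · exact h.le
    · rw [h]
  have h2 : c.b.height c'.x ≤ c'.a.height c'.x := by
    by_contra hc
    have := (under_rungTop c c.b).1 ((h c.b).2 ((under_rungTop c' c.b).2 (Or.inl (not_le.1 hc))))
    rcases this with h | h
    · rw [c.height_eq] at h; exact lt_irrefl _ h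
    · exact c.a_ne_b h.symm
  refine ⟨h1, h2, ?_⟩
  by_contra hc
  have := c.height_lt_of_gt (not_le.1 hc)
  linarith

/-- A boundary walk can be followed, forwards or backwards, to half-edges based further right until
it reaches a representative. Finiteness makes this terminate and lets orbits be traversed in both
directions. -/
theorem exists_face (h3 : ∀ i, row i ≤ 2) (hN : 0 < N) (d : Half row) :
    ∃ x : Face row, OnOrbit step (x.half hN) d := by
  let Hit : Half row → Prop := fun d => ∃ x : Face row, OnOrbit step (x.half hN) d
  have fwd : ∀ d, Hit d → Hit (step d) := fun d ⟨x, hx⟩ => ⟨x, hx.trans (.step d)⟩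
  have bwd : ∀ d, Hit (step d) → Hit d :=
    fun d ⟨x, hx⟩ => ⟨x, hx.trans ((OnOrbit.step d).symm (step_injective h3))⟩
  have hitA : ∀ a : Arc row, Hit (.lineW a.right) := fun a => ⟨.inr (.inl a), .refl _⟩
  have hitX : ∀ c : Crossing row, Hit c.rungTop := fun c => ⟨.inr (.inr c), .refl _⟩
  have hitS : ∀ j (h : IsDouble row j), Hit (.stemTop j h) := by
    intro j h
    obtain ⟨a, rfl⟩ := h.1
    exact bwd _ (hitA a)
  have key : ∀ d : Half row, ((∃ a, d.arc? = some a) ∨ ∃ i, d = .lineW i) → Hit d := by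
    have wf : WellFounded fun d e : Half row => e.pos < d.pos :=
      have : Std.Irrefl fun d e : Half row => e.pos < d.pos := ⟨fun _ => lt_irrefl _⟩
      have : IsTrans (Half row) fun d e => e.pos < d.pos := ⟨fun _ _ _ h1 h2 => h2.trans h1⟩
      Finite.wellFounded_of_trans_of_irrefl _
    intro d
    induction d using wf.induction with
    | _ d ih =>
    have next : ∀ i : Fin N, ((i : ℕ) : ℚ) = d.pos → Hit (.lineW (finRotate N i)) := by
      intro i hi
      have := finRotate_val i
      split_ifs at this
      · refine ih _ ?_ (Or.inr ⟨_, rfl⟩)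
        rw [← hi]
        change ((i : ℕ) : ℚ) < ((finRotate N i : Fin N) : ℕ)
        rw [this]
        exact_mod_cast Nat.lt_succ_self _
      · rw [show finRotate N i = ⟨0, hN⟩ from Fin.ext this]
        exact ⟨.inl false, .refl _⟩
    -- A half-edge that follows an eastward `u` at its vertex is the step after `opp u`, which is
    -- based further right.
    have west : ∀ (u : Half row) (b : Arc row), u.arc? = some b → u.East → u.pos = d.pos →
        Hit (rot u) := by
      intro u b hb hu hp
      rw [← step_opp h3]
      exact fwd _ (ih _ (hp ▸ (opp_east_spec hb hu).2.2.1) (Or.inl ⟨b, arc?_opp hb⟩))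
    rintro (⟨a, ha⟩ | ⟨i, rfl⟩)
    · by_cases hd : d.East
      · obtain ⟨v1, v2, v3, -⟩ := opp_east_spec ha hd
        apply bwd
        change Hit (rot (opp d))
        generalize opp d = v at *
        cases v with
        | arcR b =>
          by_cases h : IsDouble row b.right
          · rw [rot_arcR h]; exact hitS _ h
          · rw [rot_arcR_of_not h]; exact hitA b
        | cross c q =>
          cases q with
          | nw => rw [rot_nw h3]; exact hitX c
          | sw => rw [rot_sw h3]; exact ih _ v3 (Or.inl ⟨_, rfl⟩)
          | _ => exact absurd trivial v2
        | arcL b => exact absurd trivial v2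
        | _ => simp [Half.arc?] at v1
      · cases d with
        | arcR b =>
          by_cases h : IsDouble row b.right
          · obtain ⟨b', hb⟩ := h.exists_left
            rw [← rot_arcL hb.symm]
            exact west (.arcL b') _ rfl trivial (by simp [Half.pos, hb])
          · rw [← upward_right h, ← step_lineW_finRotate]
            exact fwd _ (next _ rfl)
        | cross c q =>
          cases q with
          | nw => rw [← rot_ne h3]; exact west _ _ rfl trivial rfl
          | sw => rw [← rot_rungBot, ← opp_rungTop]; exact fwd _ (hitX c)
          | _ => exact absurd trivial hd
        | arcL b => exact absurd trivial hd
        | _ => simp [Half.arc?] at ha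
    · rcases upward_cases (row := row) i with ⟨h, e⟩ | ⟨a, rfl, h, e⟩ | ⟨a, rfl, h, e⟩ | ⟨-, -, e⟩
      · obtain ⟨a, rfl⟩ := h.1
        exact hitA a
      · exact hitA a
      · rw [← rot_arcL_of_not h]
        exact west (.arcL a) _ rfl trivial rfl
      · rw [← e, ← step_lineW_finRotate]
        exact fwd _ (next i rfl)
  cases d with
  | lineE i => exact ⟨.inl true, onOrbit_step_lineE h3 _ _⟩
  | lineW i => exact key _ (Or.inr ⟨i, rfl⟩)
  | stemBot j h =>
    rw [← upward_of_isDouble h, ← step_lineW_finRotate]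
    exact fwd _ (key _ (Or.inr ⟨_, rfl⟩))
  | stemTop j h => exact hitS j h
  | arcL a => exact key _ (Or.inl ⟨a, rfl⟩)
  | arcR a => exact key _ (Or.inl ⟨a, rfl⟩)
  | cross c q => exact key _ (Or.inl ⟨_, rfl⟩)
  | rung c o =>
    rcases rung_cases c o with h | h <;> rw [h]
    · exact hitX c
    · apply bwd
      rw [step, opp_rungBot, rot_rungTop]
      exact key _ (Or.inl ⟨_, rfl⟩)

/-- Apart from the outside, whose walk consists of `lineE` half-edges only, the set of arcs above a
face recovers its representative. -/
theorem face_half_injective (h3 : ∀ i, row i ≤ 2) (hN : 0 < N) {x y : Face row}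
    (h : OnOrbit step (x.half hN) (y.half hN)) : x = y := by
  have hA : ∀ a b : Arc row,
      (∀ e : Arc row, Under (.lineW a.right) e ↔ Under (.lineW b.right) e) → a.right ≤ b.right :=
    fun a b h => ((h b).2 ⟨b.left_lt_right, le_rfl⟩).2
  -- If the sets agreed, `c.a` would cover `a.right` but `c.b` would not, forcing `a.right ≤
  -- c.b.left`; yet `a` passes over the crossing or through it, so it ends to the right of `c.x`.
  have hX : ∀ (a : Arc row) (c : Crossing row),
      ¬ ∀ e, Under (.lineW a.right) e ↔ Under c.rungTop e := by
    intro a c h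
    have h1 := (h c.a).2 ((under_rungTop c c.a).2 (Or.inr rfl))
    have h2 : ¬ Under (.lineW a.right) c.b := fun hb => by
      rcases (under_rungTop c c.b).1 ((h c.b).1 hb) with h | h
      · rw [c.height_eq] at h; exact lt_irrefl _ h
      · exact c.a_ne_b h.symm
    have h4 : a.right ≤ c.b.left := by
      by_contra hc
      exact h2 ⟨not_le.1 hc, h1.2.trans c.right_lt.le⟩
    have h5 : c.x ^ 2 < a.height c.x := by
      rcases (under_rungTop c a).1 ((h a).1 ⟨a.left_lt_right, le_rfl⟩) with h | h
      · exact c.sq_lt.trans h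
      · rw [h]; exact c.sq_lt
    have h6 : ((a.right : ℕ) : ℚ) ≤ (c.b.left : ℕ) := Nat.cast_le.2 h4
    linarith [(Arc.lt_right_of_sq_lt h5).2, c.lt_x]
  have h0 : ∀ e : Arc row, ¬ Under (.lineW ⟨0, hN⟩) e := fun e he => by
    have := he.1
    simp [Fin.lt_def] at this
  have hA0 : ∀ a : Arc row, ¬ ∀ e, Under (.lineW ⟨0, hN⟩) e ↔ Under (.lineW a.right) e :=
    fun a h => h0 a ((h a).2 ⟨a.left_lt_right, le_rfl⟩)
  have hX0 : ∀ c : Crossing row, ¬ ∀ e, Under (.lineW ⟨0, hN⟩) e ↔ Under c.rungTop e :=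
    fun c h => h0 c.a ((h c.a).2 ((under_rungTop c c.a).2 (Or.inr rfl)))
  have hE : ∀ x : Face row, (∃ i, x.half hN = .lineE i) → x = .inl true := by
    rintro ((_ | _) | a | c) ⟨i, hi⟩
    · simp [Face.half] at hi
    · rfl
    · simp [Face.half] at hi
    · simp [Face.half, Crossing.rungTop] at hi
  by_cases hx : ∃ i, x.half hN = .lineE i
  · obtain ⟨i, hi⟩ := hx
    rw [hi] at h
    rw [hE x ⟨i, hi⟩, hE y (lineE_of_onOrbit_step h)]
  obtain ⟨hy, hu⟩ := under_of_onOrbit_step h3 hx h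
  rcases x with (_ | _) | a | c <;> rcases y with (_ | _) | a' | c'
  · rfl
  · exact absurd ⟨_, rfl⟩ hy
  · exact absurd (fun e => (hu e).symm) (hA0 a')
  · exact absurd (fun e => (hu e).symm) (hX0 c')
  iterate 4 exact absurd ⟨_, rfl⟩ hx
  · exact absurd hu (hA0 a)
  · exact absurd ⟨_, rfl⟩ hy
  · exact congrArg (fun a => Sum.inr (Sum.inl a)) (Arc.ext_right (le_antisymm
      (hA a a' fun e => (hu e).symm) (hA a' a hu)))
  · exact absurd (fun e => (hu e).symm) (hX a c')
  · exact absurd hu (hX0 c)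
  · exact absurd ⟨_, rfl⟩ hy
  · exact absurd hu (hX a' c)
  · obtain ⟨p1, p2, p3⟩ := x_le_x_of_under hu
    obtain ⟨q1, q2, q3⟩ := x_le_x_of_under fun e => (hu e).symm
    have hxx : c.x = c'.x := le_antisymm p3 q3
    refine congrArg (fun c => Sum.inr (Sum.inr c)) (Crossing.eq_of_point_eq h3 hxx ?_)
    rw [← hxx] at q1
    exact le_antisymm p1 q1

theorem numOrbits_step (h3 : ∀ i, row i ≤ 2) (hN : 0 < N) : numOrbits (step (row := row)) =
    2 + Nat.card (Arc row) + Nat.card (Crossing row) := by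
  rw [numOrbits_eq_card (step_injective h3) (Face.half hN) (exists_face h3 hN)
    (fun x y h => face_half_injective h3 hN h)]
  rw [Nat.card_sum, Nat.card_sum]
  simp only [Nat.card_eq_fintype_card, Fintype.card_bool]
  ring

/-- With `D` double points, `A` arcs and `X` crossings, `V = N + D + 2X`, `E = N + D + A + 3X` and
`F = 2 + A + X`, so `V - E + F = 2` with one component. For `N = 0` the graph is empty and every
count is zero. -/
theorem isPlanar (h3 : ∀ i, row i ≤ 2) : (graph row).IsPlanar := by
  rcases Nat.eq_zero_or_pos N with rfl | hN
  · have hE : IsEmpty (graph row).Half := by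
      refine ⟨fun d => ?_⟩
      cases d with
      | arcL a => exact a.left.elim0
      | arcR a => exact a.left.elim0
      | cross c q => exact c.a.left.elim0
      | rung c o => exact c.a.left.elim0
      | lineE i => exact i.elim0
      | lineW i => exact i.elim0
      | stemBot j h => exact j.elim0
      | stemTop j h => exact j.elim0
    have h0 : ∀ f : (graph row).Half → (graph row).Half, numOrbits f = 0 := fun f => by
      rw [numOrbits, Set.range_eq_empty, Set.ncard_empty]
    have : IsEmpty (Quot fun d e : (graph row).Half => e = (graph row).rot d ∨
        e = (graph row).opp d) := ⟨fun q => Quot.ind (β := fun _ => False) (fun d => hE.false d) q⟩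
    rw [IsPlanar, h0, h0, h0, numComponents, Nat.card_of_isEmpty]
  · rw [IsPlanar, numComponents_graph h3 hN]
    have h1 := numOrbits_rot h3
    have h2 := numOrbits_opp h3
    have h4 := numOrbits_step h3 hN
    change numOrbits rot + numOrbits step = numOrbits opp + 2 * 1
    omega

theorem isWeb (h3 : ∀ i, row i ≤ 2) : (graph row).IsWeb where
  finite := finite_half row
  rot_bijective := rot_bijective h3
  opp_opp := opp_opp h3
  opp_ne := opp_ne
  planar := isPlanar h3
  circle := by
    refine ⟨{d | ∃ i, d = .lineE i}, fun d => ?_, ?_, ?_, ?_⟩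
    · constructor
      · rintro ⟨i, rfl | rfl⟩
        · exact Or.inl ⟨i, rfl⟩
        · exact Or.inr ⟨_, rfl⟩
      · rintro (⟨i, rfl⟩ | ⟨i, hi⟩)
        · exact ⟨i, Or.inl rfl⟩
        · refine ⟨finRotate N i, Or.inr ?_⟩
          rw [← opp_opp h3 d]
          exact congrArg opp hi
    · rintro _ ⟨i, rfl⟩ ⟨j, hj⟩
      exact Half.noConfusion rfl (heq_of_eq rfl) (heq_of_eq hj)
    · rintro _ ⟨i, rfl⟩ e
      constructor
      · rintro ⟨j, rfl⟩
        exact onOrbit_step_lineE h3 i j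
      · exact lineE_of_onOrbit_step
    · rintro _ ⟨i, rfl⟩ _ ⟨j, rfl⟩ h
      have := OnOrbit.invariant (g := Half.vertex) (vertex_rot h3) h
      rw [Sum.inl.inj this]
  boundary_degree := boundary_degree h3
  trivalent := trivalent h3
  directed := fun d => out_opp
  source_or_sink := fun d e => source_or_sink h3

end Faces

end MDiagram

/-! ### Parity of interior faces of a web -/

namespace DiskGraph

theorem IsWeb.faceStep_injective {G : DiskGraph} (hG : G.IsWeb) :
    Function.Injective G.faceStep :=
  hG.rot_bijective.1.comp (Function.LeftInverse.injective hG.opp_opp)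

theorem IsWeb.opp_mem_line {G : DiskGraph} (hG : G.IsWeb) {d : G.Half} :
    G.opp d ∈ G.line ↔ d ∈ G.line := by
  obtain ⟨outer, h, -⟩ := hG.circle
  rw [h, h, hG.opp_opp, or_comm]

theorem IsInteriorFace.of_onOrbit {G : DiskGraph} {d e : G.Half} (hd : G.IsInteriorFace d)
    (h : OnOrbit G.faceStep d e) : G.IsInteriorFace e :=
  fun _ hg => hd _ (h.trans hg)

/-- Sources and sinks alternate along the boundary of an interior face of a web. -/
theorem IsWeb.out_faceStep {G : DiskGraph} (hG : G.IsWeb) {d : G.Half}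
    (hd : G.IsInteriorFace d) : G.out (G.faceStep d) ↔ ¬ G.out d := by
  have h0 := hd d (.refl _)
  rw [← hG.directed d h0]
  exact (hG.source_or_sink _ _ (fun h => h0 (hG.opp_mem_line.1 h)) (hd _ (.step _)) (.step _)).symm

/-- Interior faces of webs have an even number of edges. -/
theorem IsWeb.even_faceLength {G : DiskGraph} (hG : G.IsWeb) {d : G.Half}
    (hd : G.IsInteriorFace d) : Even (G.faceLength d) := by
  have key : ∀ n, G.out (G.faceStep^[n] d) ↔ (G.out d ↔ Even n) := by
    intro n
    induction n with
    | zero => simp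
    | succ n ih =>
      rw [Function.iterate_succ_apply', hG.out_faceStep (hd.of_onOrbit ⟨n, rfl⟩), ih,
        Nat.even_add_one]
      tauto
  have h := key (G.faceLength d)
  rw [faceLength, Function.iterate_minimalPeriod] at h
  unfold faceLength
  tauto

/-- `minimalPeriod` takes the default value 0 at non-periodic points; an injective map of a finite
set has none. -/
theorem IsWeb.faceLength_pos {G : DiskGraph} (hG : G.IsWeb) (d : G.Half) :
    0 < G.faceLength d :=
  have := hG.finite
  Function.minimalPeriod_pos_of_mem_periodicPts (hG.faceStep_injective.mem_periodicPts d)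

end DiskGraph

namespace MDiagram

/-! ### No bigons or quadrilaterals -/

section Quadrilaterals

variable {N : ℕ} {row : Fin N → ℕ}

/-- First and second arcs alternate at the corners of the faces. -/
theorem isFirst_rot (h3 : ∀ i, row i ≤ 2) {d : Half row} {a b : Arc row} (ha : d.arc? = some a)
    (hb : (rot d).arc? = some b) : b.IsFirst ↔ ¬ a.IsFirst := by
  cases d with
  | arcL g =>
    obtain rfl : g = a := by simpa [Half.arc?] using ha
    by_cases h : IsDouble row g.left
    · obtain ⟨f, hf⟩ := h.1
      rw [rot_arcL hf] at hb
      obtain rfl : f = b := by simpa [Half.arc?] using hb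
      exact iff_of_true (isFirst_of_isDouble h3 (isDouble_right hf)) (not_isFirst_of_isDouble h)
    · rw [rot_arcL_of_not h] at hb
      simp [Half.arc?] at hb
  | arcR g =>
    by_cases h : IsDouble row g.right
    · rw [rot_arcR h] at hb
      simp [Half.arc?] at hb
    · rw [rot_arcR_of_not h] at hb
      simp [Half.arc?] at hb
  | cross c q =>
    have hf := c.isFirst_b h3
    cases q with
    | ne =>
      rw [rot_ne h3] at hb
      simp only [Half.arc?, Crossing.arc, Option.some.injEq] at ha hb
      subst ha hb
      tauto
    | nw =>
      rw [rot_nw h3] at hb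
      simp [Half.arc?, Crossing.rungTop] at hb
    | sw =>
      rw [rot_sw h3] at hb
      simp only [Half.arc?, Crossing.arc, Option.some.injEq] at ha hb
      subst ha hb
      tauto
    | se =>
      rw [rot_se h3] at hb
      simp [Half.arc?, Crossing.rungBot] at hb
  | _ => simp [Half.arc?] at ha

/-- The rightmost point of an interior face is a crossing. -/
theorem exists_rungTop_of_isInteriorFace (h3 : ∀ i, row i ≤ 2)
    {d : Half row} (hd : (graph row).IsInteriorFace d) :
    ∃ c : Crossing row, OnOrbit step d c.rungTop := by
  have hN : 0 < N := by
    cases d with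
    | arcL a => exact a.left.pos
    | arcR a => exact a.left.pos
    | cross c q => exact c.a.left.pos
    | rung c o => exact c.a.left.pos
    | lineE i => exact i.pos
    | lineW i => exact i.pos
    | stemBot j h => exact j.pos
    | stemTop j h => exact j.pos
  obtain ⟨x, hx⟩ := exists_face h3 hN d
  have hx' := hx.symm (step_injective h3)
  rcases x with (_ | _) | a | c
  · exact absurd ⟨_, Or.inr rfl⟩ (hd _ hx')
  · exact absurd ⟨_, Or.inl rfl⟩ (hd _ hx')
  · exact absurd ⟨_, Or.inr rfl⟩ (hd _ hx')
  · exact ⟨c, hx'⟩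

/-- The walk starts down the rung and leftwards along `c.b`, and a closed walk of four steps must
return along `c.a`. The third edge is either on an arc, against the alternation of types, or a rung,
making `c.a` and `c.b` cross again. -/
theorem step_four_ne (h3 : ∀ i, row i ≤ 2)
    {c : Crossing row} (hd : (graph row).IsInteriorFace c.rungTop) :
    step (step (step (step c.rungTop))) ≠ c.rungTop := by
  intro h
  have hline : ∀ i, step (step c.rungTop) ≠ .lineW i := fun i hi =>
    hd (step (step c.rungTop)) ⟨2, rfl⟩ ⟨i, Or.inr hi⟩
  have e1 : step c.rungTop = .cross c .sw := by rw [step, opp_rungTop, rot_rungBot]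
  rw [e1] at h hline
  -- Only `nw` is followed by the upper half of the rung, so the fourth edge must arrive along
  -- `c.a`.
  have e4 : opp (step (step (.cross c .sw))) = .cross c .nw :=
    (rot_bijective h3).1 (h.trans (rot_nw h3 c).symm)
  have a4 : (step (step (.cross c .sw))).arc? = some c.a := by
    rw [← opp_opp h3 (step (step (.cross c .sw))), e4]
    exact arc?_opp rfl
  have hf := c.isFirst_b h3
  obtain ⟨v1, v2, v3, -⟩ := opp_west_spec (d := .cross c .sw) (a := c.b) rfl id
  rcases hg : (step (.cross c .sw)).arc? with _ | g
  · rw [step] at hg a4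
    rw [step] at hline a4
    generalize opp (Half.cross c Quadrant.sw) = v at *
    cases v with
    | arcL b =>
      by_cases hb : IsDouble row b.left
      · obtain ⟨a, ha⟩ := hb.1
        rw [rot_arcL ha] at hg
        simp [Half.arc?] at hg
      · exact hline _ (rot_arcL_of_not hb)
    | cross c' q =>
      cases q with
      | ne =>
        rw [rot_ne h3] at hg
        simp [Half.arc?] at hg
      -- The third edge is the rung of `c'`, after which the walk leaves on `c.a`. So `c'` lies on
      -- both `c.a` and `c.b` and equals `c`, although it is strictly to the left.
      | se =>
        rw [rot_se h3, opp_rungBot, rot_rungTop] at a4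
        have := Crossing.eq_of_on (Half.arc?_cross_on a4) (Half.arc?_cross_on v1)
        subst this
        exact lt_irrefl _ v3
      | _ => exact absurd v2 id
    | arcR b => exact absurd v2 id
    | _ => simp [Half.arc?] at v1
  -- Two alternations, from `c.b` to `g` and from `g` to `c.a`, would give `c.a` and `c.b` the same
  -- type.
  · have f1 := isFirst_rot h3 v1 hg
    have f2 := isFirst_rot h3 (arc?_opp hg) a4
    tauto

theorem faceLength_ne (h3 : ∀ i, row i ≤ 2) {d : Half row} (hd : (graph row).IsInteriorFace d) :
    (graph row).faceLength d ≠ 2 ∧ (graph row).faceLength d ≠ 4 := by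
  obtain ⟨c, hc⟩ := exists_rungTop_of_isInteriorFace h3 hd
  -- Both lengths 2 and 4 would make the fourth iterate of `step` fix `d`, hence every half-edge on
  -- the same face.
  have h4 : ¬ (graph row).faceLength d ∣ 4 := by
    intro h
    have hp : step^[4] d = d := Function.isPeriodicPt_iff_minimalPeriod_dvd.2 h
    refine step_four_ne h3 (hd.of_onOrbit hc) ?_
    obtain ⟨n, hn⟩ := hc
    change step^[4] c.rungTop = _
    rw [← hn, ← Function.iterate_add_apply, add_comm, Function.iterate_add_apply, hp]
  constructor <;> intro h <;> rw [h] at h4 <;> norm_num at h4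

theorem isIrreducibleWeb (h3 : ∀ i, row i ≤ 2) : (graph row).IsIrreducibleWeb := by
  refine ⟨isWeb h3, fun d hd => ?_⟩
  have h1 := faceLength_ne h3 hd
  have h2 := (isWeb h3).faceLength_pos d
  obtain ⟨k, hk⟩ := (isWeb h3).even_faceLength hd
  omega

theorem noIsolatedPoint (h : ∀ i : Fin N, ∃ a : Arc row, a.left = i ∨ a.right = i) :
    (graph row).NoIsolatedPoint := by
  rintro d ⟨i, hi⟩
  refine ⟨upward i, ?_, ?_⟩
  · rcases hi with rfl | rfl
    · exact ⟨1, rfl⟩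
    · exact ⟨2, rfl⟩
  · rintro ⟨j, hj⟩
    rcases upward_cases (row := row) i with ⟨_, e⟩ | ⟨a, _, _, e⟩ | ⟨a, _, _, e⟩ | ⟨h1, h2, _⟩
    · simp [e] at hj
    · simp [e] at hj
    · simp [e] at hj
    · obtain ⟨a, ha | ha⟩ := h i
      · exact h2 ⟨a, ha⟩
      · exact h1 ⟨a, ha⟩

end Quadrilaterals

end MDiagram

/-! ### Arcs of a standard tableau -/

namespace StandardTableau

open MDiagram

variable {μ : YoungDiagram} (T : StandardTableau μ)

/-- The column containing a given number. -/
def col (k : Fin μ.card) : ℕ := (T.entry.symm k).1.2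

theorem cell_mem (k : Fin μ.card) : (T.row k, T.col k) ∈ μ.cells := (T.entry.symm k).2

theorem entry_cell (k : Fin μ.card) : T.entry ⟨(T.row k, T.col k), T.cell_mem k⟩ = k :=
  T.entry.apply_symm_apply k

theorem row_entry (c : {c : ℕ × ℕ // c ∈ μ.cells}) : T.row (T.entry c) = c.1.1 := by
  simp [row]

theorem col_entry (c : {c : ℕ × ℕ // c ∈ μ.cells}) : T.col (T.entry c) = c.1.2 := by
  simp [col]

theorem eq_of_row_col {k l : Fin μ.card} (h1 : T.row k = T.row l) (h2 : T.col k = T.col l) :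
    k = l :=
  T.entry.symm.injective (Subtype.ext (Prod.ext h1 h2))

theorem col_lt_col {k l : Fin μ.card} (h1 : T.row k = T.row l) (h2 : k < l) :
    T.col k < T.col l := by
  by_contra hc
  rcases (not_lt.1 hc).lt_or_eq with h | h
  · have hm : (T.row k, T.col l) ∈ μ.cells := h1 ▸ T.cell_mem l
    have := T.row_lt _ _ _ hm (T.cell_mem k) h
    rw [T.entry_cell] at this
    have e : T.entry ⟨(T.row k, T.col l), hm⟩ = l :=
      T.eq_of_row_col (by rw [T.row_entry]; exact h1) (by rw [T.col_entry])
    rw [e] at this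
    exact absurd h2 (not_lt.2 this.le)
  · exact h2.ne (T.eq_of_row_col h1 h.symm)

theorem row_le_two (hμ : μ.colLen 0 ≤ 3) (k : Fin μ.card) : T.row k ≤ 2 := by
  have h : (T.row k, 0) ∈ μ := μ.up_left_mem le_rfl (Nat.zero_le _) (T.cell_mem k)
  have := YoungDiagram.mem_iff_lt_colLen.1 h
  omega

/-- Every number above the bottom row is joined to a number to its left. -/
theorem exists_arc_right {i : Fin μ.card} (hi : T.row i ≠ 0) :
    ∃ a : Arc T.row, a.right = i := by
  obtain ⟨r, hr⟩ := Nat.exists_eq_succ_of_ne_zero hi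
  have hmem : ∀ j : Fin (T.col i + 1), (r, (j : ℕ)) ∈ μ.cells := fun j =>
    μ.up_left_mem (by omega) (Nat.lt_succ_iff.1 j.2) (T.cell_mem i)
  -- The entries of the row below, in the columns up to that of `i`: all are smaller than `i`, hence
  -- candidates for its partner.
  let f : Fin (T.col i + 1) → Fin μ.card := fun j => T.entry ⟨(r, j), hmem j⟩
  have frow : ∀ j, T.row (f j) + 1 = T.row i := fun j => by rw [T.row_entry, hr]
  have flt : ∀ j, f j < i := by
    intro j
    have hm : (T.row i, (j : ℕ)) ∈ μ.cells :=
      μ.up_left_mem le_rfl (Nat.lt_succ_iff.1 j.2) (T.cell_mem i)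
    have h1 : f j < T.entry ⟨(T.row i, j), hm⟩ := T.col_lt _ _ _ _ _ (by omega)
    refine h1.trans_le ?_
    rcases (Nat.lt_succ_iff.1 j.2).lt_or_eq with h | h
    · exact (T.row_lt _ _ _ hm (T.cell_mem i) h).le.trans_eq (T.entry_cell i)
    · exact (T.eq_of_row_col (T.row_entry ⟨_, hm⟩) ((T.col_entry ⟨_, hm⟩).trans h)).le
  have : ∃ j, ∀ i' < i, T.row i' = T.row i → partner T.row i' ≠ some (f j) := by
    by_contra! hc
    choose g g1 g2 g3 using hc
    -- Pigeonhole: only `T.col i` numbers precede `i` in its row, so they cannot use up all `T.col i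
    -- + 1` candidates.
    let h : Fin (T.col i + 1) → Fin (T.col i) := fun j => ⟨T.col (g j), T.col_lt_col (g2 j) (g1 j)⟩
    have hinj : Function.Injective h := by
      intro j j' hj
      have e : g j = g j' :=
        T.eq_of_row_col ((g2 j).trans (g2 j').symm) (congrArg Fin.val hj)
      have e2 : f j = f j' := by
        have := g3 j
        rw [e, g3 j'] at this
        exact (Option.some.inj this).symm
      have := congrArg T.col e2
      rw [T.col_entry, T.col_entry] at this
      exact Fin.ext this
    have := Fintype.card_le_of_injective h hinj
    simp at this
  obtain ⟨j, hj⟩ := this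
  obtain ⟨k, hk⟩ := exists_partner (flt j) (frow j) hj
  exact ⟨⟨k, i, hk⟩, rfl⟩

/-- If the two lowest rows have the same length, then every number on the bottom row is joined to
one on the row above. -/
theorem exists_arc_left (h : μ.rowLen 0 = μ.rowLen 1) {i : Fin μ.card} (hi : T.row i = 0) :
    ∃ a : Arc T.row, a.left = i := by
  have hmem : ∀ j : Fin (μ.rowLen 0), (1, (j : ℕ)) ∈ μ.cells := fun j =>
    YoungDiagram.mem_iff_lt_rowLen.2 (h ▸ j.2)
  have hex : ∀ j : Fin (μ.rowLen 0), ∃ a : Arc T.row, a.right = T.entry ⟨(1, j), hmem j⟩ :=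
    fun j => T.exists_arc_right (by rw [T.row_entry]; exact one_ne_zero)
  choose a ha using hex
  have arow : ∀ j, T.row (a j).left = 0 := fun j => by
    have := (a j).row_left
    rw [ha, T.row_entry] at this
    simpa using this
  have acol : ∀ k, T.row k = 0 → T.col k < μ.rowLen 0 := fun k hk =>
    YoungDiagram.mem_iff_lt_rowLen.1 (hk ▸ T.cell_mem k)
  -- Sends a column of the middle row to the column of its partner. It is injective between finite
  -- sets of equal size, so every bottom entry is a partner.
  let g : Fin (μ.rowLen 0) → Fin (μ.rowLen 0) := fun j => ⟨T.col (a j).left, acol _ (arow j)⟩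
  have hinj : Function.Injective g := by
    intro j j' hj
    have e : (a j).left = (a j').left :=
      T.eq_of_row_col ((arow j).trans (arow j').symm) (congrArg Fin.val hj)
    have e2 := congrArg (fun a => T.col a.right) (Arc.ext_left e)
    simp only [ha, T.col_entry] at e2
    exact Fin.ext e2
  obtain ⟨j, hj⟩ := Finite.injective_iff_surjective.1 hinj ⟨T.col i, acol i hi⟩
  exact ⟨a j, T.eq_of_row_col ((arow j).trans hi.symm) (congrArg Fin.val hj)⟩

theorem noIsolatedPoint (h : μ.rowLen 0 = μ.rowLen 1) :
    T.resolvedMDiagram.NoIsolatedPoint := by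
  refine MDiagram.noIsolatedPoint (row := T.row) fun i => ?_
  by_cases hi : T.row i = 0
  · obtain ⟨a, ha⟩ := T.exists_arc_left h hi
    exact ⟨a, Or.inl ha⟩
  · obtain ⟨a, ha⟩ := T.exists_arc_right hi
    exact ⟨a, Or.inr ha⟩

end StandardTableau

theorem mainTheorem4 (μ : YoungDiagram) (hμ : μ.colLen 0 ≤ 3) (T : StandardTableau μ) :
    (∀ d, T.resolvedMDiagram.IsInteriorFace d → T.resolvedMDiagram.faceLength d ≠ 2) ∧
    (∀ d, T.resolvedMDiagram.IsInteriorFace d → ¬ Odd (T.resolvedMDiagram.faceLength d)) ∧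
    (∀ d, T.resolvedMDiagram.IsInteriorFace d → T.resolvedMDiagram.faceLength d ≠ 4) ∧
    T.resolvedMDiagram.IsIrreducibleWeb ∧
    (∀ n k : ℕ, μ.rowLen 0 = k → μ.rowLen 1 = k → μ.rowLen 2 = n →
      T.resolvedMDiagram.IsIrreducibleWeb ∧ T.resolvedMDiagram.NoIsolatedPoint) := by
  have h3 := T.row_le_two hμ
  have hW : T.resolvedMDiagram.IsIrreducibleWeb := MDiagram.isIrreducibleWeb h3
  exact ⟨fun d hd => (MDiagram.faceLength_ne h3 hd).1,
    fun d hd => Nat.not_odd_iff_even.2 (hW.1.even_faceLength hd),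
    fun d hd => (MDiagram.faceLength_ne h3 hd).2, hW,
    fun n k h0 h1 _ => ⟨hW, T.noIsolatedPoint (h0.trans h1.symm)⟩⟩
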